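/- **Setting.** Let $U$ be a real rational function of one variable, let $\langle u,v\rangle_L=u_1v_1+u_2v_2-u_3v_3$ on $\mathbb R^3$, and let $T\mathbb H^2=\{(x,y)\in\mathbb R^3\times\mathbb R^3:\ \langle x,x\rangle_L=-1,\ x_3>0,\ \langle x,y\rangle_L=0\}$. With the Lorentz gradient $\nabla_L f=(\partial_1f,\partial_2f,-\partial_3f)$ and the potential $V(x)=U(x_2-x_3)$, the motion on the hyperbolic plane is $$\dot x=y,\qquad \dot y=-\nabla_LV(x)+\bigl(\langle y,y\rangle_L-\langle x,\nabla_LV(x)\rangle_L\bigr)x \tag{1}$$ on the set of points of $T\mathbb H^2$ at which $x_2-x_3$ is not a pole of $U$. Let $\widetilde\Gamma(x,y)=(x_2-x_3,\;y_2-y_3,\;\langle y,y\rangle_L)\in\mathbb R^3$, let $D$ be the image under $\widetilde\Gamma$ of this phase space, and consider on $D$ the reduced system $$\dot w_1=w_2,\qquad \dot w_2=w_1w_3-w_1^2U'(w_1),\qquad \dot w_3=-2w_2U'(w_1). \tag{2}$$ Put $j^2=w_1^2w_3-w_2^2$ and $h=\tfrac12w_3+U(w_1)$; for real $c_1\ge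 0$, $c_2$ let $L_{c_1,c_2}=\{w\in D:\ j^2(w)=c_1,\ h(w)=c_2\}$. A trajectory is the image of a maximal solution; a parabola in a real vector space is a set $\{a+su+s^2v:\ s\in\mathbb R\}$ with $u,v$ linearly independent. All inverse images under $\widetilde\Gamma$ are taken in the phase space of (1). **Proposition.** (a) The stationary points of (2) in $D$ are exactly the points $z_\rho=(\rho,0,\rho U'(\rho))$ with $\rho<0$ not a pole of $U$ and $\rho U'(\rho)\ge0$. If $U'(\rho)\ne0$, the inverse image of $z_\rho$ under $\widetilde\Gamma$ is a union of two disjoint parabolas, each of which is a trajectory of (1). If $U'(\rho)=0$, the inverse image of $z_\rho$ is a single parabola and consists of stationary points of (1). (b) Every nonstationary solution of (2) in $D$ is contained in $L_{c_1,c_2}$ for some $c_1\ge0$ and $c_2\in\mathbb R$. For all $c_1\ge 0$ and $c_2\in\mathbb R$: * At every nonstationary point $w$ of (2) in $L_{c_1,c_2}$ the set $L_{c_1,c_2}$ is smooth: the derivative of $(j^2,h)$ at $w$ has rank $2$, and near $w$ the set $L_{c_1,c_2}$ is a one-dimensional $C^\infty$ submanifold of $\mathbb R^3$. * If $L_{c_1,c_2}$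 contains no stationary point of (2), then it is a one-dimensional submanifold, and each of its connected components is a trajectory of (2). * In general (in particular if $L_{c_1,c_2}$ contains stationary points) the complement in $L_{c_1,c_2}$ of the set of stationary points is a union of (nonstationary) trajectories of (2). Every nonstationary trajectory in $L_{c_1,c_2}$ is either periodic, and then it is an entire connected component of $L_{c_1,c_2}$ (which therefore contains no stationary point), or its forward and backward limit sets, taken in $\mathbb R^3$, consist of stationary points of the vector field (2) on $\{w\in\mathbb R^3: w_1 \text{ is not a pole of } U\}$. (c) The inverse image under $\widetilde\Gamma$ of a nonstationary trajectory of (2) in $D$ is an unbounded invariant set of (1) that contains no stationary point of (1). -/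

import Mathlib

open Set

noncomputable section

/-! ### Solutions, trajectories, stationary points and limit sets of `ż = F z` on a set `D` -/

section Dynamics

variable {E : Type*} [NormedAddCommGroup E] [NormedSpace ℝ E]

/-- `γ` is a solution of `ż = F z` that stays in `D`, on the nonempty open interval `I`. -/
structure IsSolution (F : E → E) (D : Set E) (I : Set ℝ) (γ : ℝ → E) : Prop where
  isOpen : IsOpen I
  ordConnected : I.OrdConnected
  nonempty : I.Nonempty
  mem : ∀ t ∈ I, γ t ∈ D
  hasDerivAt : ∀ t ∈ I, HasDerivAt γ (F (γ t)) t

/-- A solution in `D` that cannot be continued, within `D`, to a larger open interval. -/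
structure IsMaximalSolution (F : E → E) (D : Set E) (I : Set ℝ) (γ : ℝ → E) : Prop where
  isSolution : IsSolution F D I γ
  maximal : ∀ (J : Set ℝ) (δ : ℝ → E), IsSolution F D J δ → I ⊆ J → EqOn γ δ I → J ⊆ I

/-- A trajectory is the set of points that a maximal solution runs through. -/
def IsTrajectory (F : E → E) (D T : Set E) : Prop :=
  ∃ (I : Set ℝ) (γ : ℝ → E), IsMaximalSolution F D I γ ∧ T = γ '' I

/-- The stationary points of `ż = F z` in `D`. -/
def stationaryPoints (F : E → E) (D : Set E) : Set E := {z | z ∈ D ∧ F z = 0}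

/-- The solution `γ` on `I` is not stationary. -/
def IsNonstationary (F : E → E) (I : Set ℝ) (γ : ℝ → E) : Prop := ∃ t ∈ I, F (γ t) ≠ 0

/-- The solution `γ` on `I` is defined for all times and periodic. -/
def IsPeriodicSolution (I : Set ℝ) (γ : ℝ → E) : Prop :=
  I = univ ∧ ∃ p : ℝ, 0 < p ∧ Function.Periodic γ p

/-- The limit set of `γ` as time tends to the right end of `I`
(the closures are taken in the whole space). -/
def forwardLimitSet (I : Set ℝ) (γ : ℝ → E) : Set E :=
  ⋂ t ∈ I, closure (γ '' (I ∩ Ici t))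

/-- The limit set of `γ` as time tends to the left end of `I`. -/
def backwardLimitSet (I : Set ℝ) (γ : ℝ → E) : Set E :=
  ⋂ t ∈ I, closure (γ '' (I ∩ Iic t))

/-- `M` is an invariant set of `ż = F z` on `D`: a solution that meets `M` stays in `M`. -/
def IsInvariantSet (F : E → E) (D M : Set E) : Prop :=
  M ⊆ D ∧ ∀ (I : Set ℝ) (γ : ℝ → E), IsSolution F D I γ →
    (∃ t ∈ I, γ t ∈ M) → ∀ t ∈ I, γ t ∈ M

/-- A parabola in a real vector space: `s ↦ a + s u + s² v` with `u`, `v` linearly independent. -/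
def IsParabola (S : Set E) : Prop :=
  ∃ a u v : E, LinearIndependent ℝ ![u, v] ∧ S = range (fun s : ℝ => a + s • u + s ^ 2 • v)

end Dynamics

/-- Near its point `w`, the set `L ⊆ ℝ³` is a one-dimensional smooth (`C^∞`) submanifold:
a local diffeomorphism `Φ` of `ℝ³` around `w` takes `L` to a piece of the first axis. -/
def IsSmoothCurveAt (L : Set (Fin 3 → ℝ)) (w : Fin 3 → ℝ) : Prop :=
  ∃ Φ : OpenPartialHomeomorph (Fin 3 → ℝ) (Fin 3 → ℝ),
    w ∈ Φ.source ∧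
    ContDiffOn ℝ (⊤ : ℕ∞) Φ Φ.source ∧
    ContDiffOn ℝ (⊤ : ℕ∞) Φ.symm Φ.target ∧
    ∀ z ∈ Φ.source, z ∈ L ↔ Φ z 1 = 0 ∧ Φ z 2 = 0

/-- `L` is a one-dimensional (embedded, smooth) submanifold of `ℝ³`. -/
def IsOneDimSubmanifold (L : Set (Fin 3 → ℝ)) : Prop := ∀ w ∈ L, IsSmoothCurveAt L w

/-! ### Motion on the hyperbolic plane.  Coordinates `x₁, x₂, x₃` are `x 0, x 1, x 2`. -/

/-- The Lorentz inner product on `ℝ^{2,1}`. -/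
def lorentz (x y : Fin 3 → ℝ) : ℝ := x 0 * y 0 + x 1 * y 1 - x 2 * y 2

/-- The tangent bundle of the hyperbolic plane, as a subset of `ℝ³ × ℝ³`. -/
def tangentHyperbolicPlane : Set ((Fin 3 → ℝ) × (Fin 3 → ℝ)) :=
  {p | lorentz p.1 p.1 = -1 ∧ 0 < p.1 2 ∧ lorentz p.1 p.2 = 0}

/-- The Lorentz gradient of `f`: the vector `g` with `⟨g, v⟩_L = Df(x) v` for all `v`. -/
def lorentzGrad (f : (Fin 3 → ℝ) → ℝ) (x : Fin 3 → ℝ) : Fin 3 → ℝ :=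
  ![fderiv ℝ f x (Pi.single 0 1), fderiv ℝ f x (Pi.single 1 1), -fderiv ℝ f x (Pi.single 2 1)]

/-- The vector field of the motion on the hyperbolic plane with potential `V`. -/
def motionField (V : (Fin 3 → ℝ) → ℝ) (p : (Fin 3 → ℝ) × (Fin 3 → ℝ)) :
    (Fin 3 → ℝ) × (Fin 3 → ℝ) :=
  (p.2, -lorentzGrad V p.1 +
    (lorentz p.2 p.2 - lorentz p.1 (lorentzGrad V p.1)) • p.1)

/-! ### Potentials `U(x₂ - x₃)` with a rational function `U`, and the reduced system -/

/-- The real numbers at which the rational function `U` has no pole. -/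
def regularArgs (U : RatFunc ℝ) : Set ℝ := {r | U.denom.eval r ≠ 0}

/-- The function `r ↦ U(r)`; only its values on `regularArgs U` are meaningful. -/
def ratFun (U : RatFunc ℝ) (r : ℝ) : ℝ := U.eval (RingHom.id ℝ) r

/-- The potential `x ↦ U(x₂ - x₃)`. -/
def parabolicPotential (U : RatFunc ℝ) (x : Fin 3 → ℝ) : ℝ := ratFun U (x 1 - x 2)

/-- The phase space of the motion: the points of the tangent bundle of the hyperbolic plane
at which the potential is defined. -/
def phaseSpace (U : RatFunc ℝ) : Set ((Fin 3 → ℝ) × (Fin 3 → ℝ)) :=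
  {p | p ∈ tangentHyperbolicPlane ∧ p.1 1 - p.1 2 ∈ regularArgs U}

/-- The reduction map `(ζ₁, ζ₂, ζ₃)`. -/
def reductionMap (p : (Fin 3 → ℝ) × (Fin 3 → ℝ)) : Fin 3 → ℝ :=
  ![p.1 1 - p.1 2, p.2 1 - p.2 2, lorentz p.2 p.2]

/-- The points of the image of the reduction map at which the reduced system is defined. -/
def reducedSpace (U : RatFunc ℝ) : Set (Fin 3 → ℝ) := reductionMap '' phaseSpace U

/-- The inverse image of a set under the reduction map. -/
def reductionPreimage (U : RatFunc ℝ) (T : Set (Fin 3 → ℝ)) :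
    Set ((Fin 3 → ℝ) × (Fin 3 → ℝ)) := phaseSpace U ∩ reductionMap ⁻¹' T

/-- The vector field of the reduced system on `ℝ³`. -/
def reducedField (U : RatFunc ℝ) (w : Fin 3 → ℝ) : Fin 3 → ℝ :=
  ![w 1, w 0 * w 2 - w 0 ^ 2 * deriv (ratFun U) (w 0), -2 * w 1 * deriv (ratFun U) (w 0)]

/-- The first integral `j²`. -/
def jSq (w : Fin 3 → ℝ) : ℝ := w 0 ^ 2 * w 2 - w 1 ^ 2

/-- The reduced Hamiltonian `h`. -/
def redHam (U : RatFunc ℝ) (w : Fin 3 → ℝ) : ℝ := w 2 / 2 + ratFun U (w 0)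

/-- The level set `j² = c₁`, `h = c₂` in the reduced space. -/
def levelSet (U : RatFunc ℝ) (c₁ c₂ : ℝ) : Set (Fin 3 → ℝ) :=
  {w | w ∈ reducedSpace U ∧ jSq w = c₁ ∧ redHam U w = c₂}

/-- The point `z_ρ = (ρ, 0, ρ U'(ρ))`. -/
def relEquilibrium (U : RatFunc ℝ) (ρ : ℝ) : Fin 3 → ℝ := ![ρ, 0, ρ * deriv (ratFun U) ρ]

end

/-! The geometric input is a description of the fibres of the reduction map. On the tangent bundle
x₂ - x₃ < 0, and the square of the momentum j of the parabolic rotations is j²(w); given w, the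
coordinate x₁ = s and the sign of j determine the point (`eq_fiberPoint`). Hence D is cut out by w₁
< 0, regularity of w₁ and j² ≥ 0 (`mem_reducedSpace_iff`). Over z_ρ one has w₂ = 0, so the fibre is
quadratic in s: one parabola for each square root j of j²(z_ρ). This gives (a).

The reduced field is the cross product ∇h × ∇(j²). So both functions are first integrals, and their
differentials are independent exactly where the field is nonzero. There the level set is a smooth
curve (`isSmoothCurveAt_levelSet`) locally swept out by a solution (`isLocalArc_levelSet`). By
uniqueness, a solution that meets such an arc runs along all of it. Nonstationary trajectories are
therefore open in the level set, and relatively closed if there are no stationary points. A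
nonstationary limit point in the level set is revisited, which forces periodicity. The closure of a
level set adds only points with w₁ = 0, where w₂ = 0 and the field vanishes
(`closure_levelSet_subset`); this gives (b).

For (c), solutions of the motion project to reduced solutions, and each fibre is unbounded because s
is free. -/

section Flow

open Filter Topology

variable {E : Type*} [NormedAddCommGroup E] [NormedSpace ℝ E] {F : E → E} {D L : Set E}
  {I J : Set ℝ} {γ δ : ℝ → E} {z : E}

/-! ### Uniqueness, maximal solutions and local arcs -/

theorem IsSolution.continuousAt (hγ : IsSolution F D I γ) {t : ℝ} (ht : t ∈ I) :
    ContinuousAt γ t := (hγ.hasDerivAt t ht).continuousAt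

theorem IsSolution.continuousOn (hγ : IsSolution F D I γ) : ContinuousOn γ I :=
  fun _ ht => (hγ.continuousAt ht).continuousWithinAt

theorem IsSolution.isPreconnected_image (hγ : IsSolution F D I γ) : IsPreconnected (γ '' I) :=
  hγ.ordConnected.isPreconnected.image γ hγ.continuousOn

theorem IsSolution.comp_add (hγ : IsSolution F D I γ) (a : ℝ) :
    IsSolution F D {t | t + a ∈ I} (fun t => γ (t + a)) where
  isOpen := hγ.isOpen.preimage (continuous_id.add continuous_const)
  ordConnected := ⟨fun x hx y hy u hu =>
    hγ.ordConnected.out hx hy ⟨by linarith [hu.1], by linarith [hu.2]⟩⟩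
  nonempty := by
    obtain ⟨t, ht⟩ := hγ.nonempty
    exact ⟨t - a, by simpa using ht⟩
  mem t ht := hγ.mem _ ht
  hasDerivAt t ht := (hγ.hasDerivAt _ ht).comp_add_const t a

/-- A field that is C¹ near a point is Lipschitz there, so Picard–Lindelöf uniqueness applies.
Smoothness refers to the ambient space; `D` need not be open. -/
theorem IsSolution.eventuallyEq (hF : ∀ z ∈ D, ContDiffAt ℝ 1 F z) (hγ : IsSolution F D I γ)
    (hδ : IsSolution F D J δ) {t : ℝ} (hI : t ∈ I) (hJ : t ∈ J) (h : γ t = δ t) :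
    γ =ᶠ[𝓝 t] δ := by
  obtain ⟨K, s, hs, hl⟩ := (hF _ (hγ.mem t hI)).exists_lipschitzOnWith
  refine ODE_solution_unique_of_eventually (v := fun _ => F) (s := fun _ => s) (K := K)
    (.of_forall fun _ => hl) ?_ ?_ h
  · filter_upwards [hγ.isOpen.mem_nhds hI, (hγ.continuousAt hI).preimage_mem_nhds hs] with u hu hus
    exact ⟨hγ.hasDerivAt u hu, hus⟩
  · filter_upwards [hδ.isOpen.mem_nhds hJ,
      (hδ.continuousAt hJ).preimage_mem_nhds (h ▸ hs)] with u hu hus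
    exact ⟨hδ.hasDerivAt u hu, hus⟩

/-- The times near which both solutions agree form an open set that is closed in the interval `I ∩
J`, by continuity and local uniqueness. -/
theorem IsSolution.eqOn (hF : ∀ z ∈ D, ContDiffAt ℝ 1 F z) (hγ : IsSolution F D I γ)
    (hδ : IsSolution F D J δ) {t : ℝ} (hI : t ∈ I) (hJ : t ∈ J) (h : γ t = δ t) :
    EqOn γ δ (I ∩ J) := by
  have key : I ∩ J ⊆ {u | γ =ᶠ[𝓝 u] δ} := by
    refine (hγ.ordConnected.inter hδ.ordConnected).isPreconnected.subset_of_closure_inter_subset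
      isOpen_setOfPred_eventually_nhds ⟨t, ⟨hI, hJ⟩, hγ.eventuallyEq hF hδ hI hJ h⟩ ?_
    rintro u ⟨hu, huI, huJ⟩
    refine hγ.eventuallyEq hF hδ huI huJ ?_
    refine tendsto_nhds_unique_of_frequently_eq (hγ.continuousAt huI) (hδ.continuousAt huJ) ?_
    exact (mem_closure_iff_frequently.1 hu).mono fun x hx => hx.self_of_nhds
  exact fun u hu => (key hu).self_of_nhds

/-- The two solutions agree on the overlap, so they glue to a solution on `I ∪ J`, and maximality
applies to it. -/
theorem IsMaximalSolution.subset_of_eq (hF : ∀ z ∈ D, ContDiffAt ℝ 1 F z)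
    (hγ : IsMaximalSolution F D I γ) (hδ : IsSolution F D J δ) {t : ℝ} (hI : t ∈ I) (hJ : t ∈ J)
    (h : γ t = δ t) : J ⊆ I := by
  classical
  have hs := hγ.isSolution
  have heq := hs.eqOn hF hδ hI hJ h
  have e1 : EqOn γ (I.piecewise γ δ) I := fun u hu => (piecewise_eq_of_mem _ _ _ hu).symm
  have e2 : EqOn δ (I.piecewise γ δ) J := fun u hu => by
    by_cases hu' : u ∈ I
    · rw [piecewise_eq_of_mem _ _ _ hu', heq ⟨hu', hu⟩]
    · rw [piecewise_eq_of_notMem _ _ _ hu']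
  refine subset_union_right.trans (hγ.maximal (I ∪ J) (I.piecewise γ δ) ?_ subset_union_left e1)
  refine ⟨hs.isOpen.union hδ.isOpen, ?_, hs.nonempty.inl, ?_, ?_⟩
  · exact (hs.ordConnected.isPreconnected.union t hI hJ
      hδ.ordConnected.isPreconnected).ordConnected
  · rintro u (hu | hu)
    · rw [← e1 hu]; exact hs.mem u hu
    · rw [← e2 hu]; exact hδ.mem u hu
  · rintro u (hu | hu)
    · rw [← e1 hu]
      exact (hs.hasDerivAt u hu).congr_of_eventuallyEq
        (e1.eventuallyEq_of_mem (hs.isOpen.mem_nhds hu)).symm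
    · rw [← e2 hu]
      exact (hδ.hasDerivAt u hu).congr_of_eventuallyEq
        (e2.eventuallyEq_of_mem (hδ.isOpen.mem_nhds hu)).symm

theorem IsMaximalSolution.eqOn_of_eq (hF : ∀ z ∈ D, ContDiffAt ℝ 1 F z)
    (hγ : IsMaximalSolution F D I γ) (hδ : IsSolution F D J δ) {t : ℝ} (hI : t ∈ I) (hJ : t ∈ J)
    (h : γ t = δ t) : EqOn γ δ J :=
  fun _ hu => hγ.isSolution.eqOn hF hδ hI hJ h ⟨hγ.subset_of_eq hF hδ hI hJ h hu, hu⟩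

theorem IsMaximalSolution.comp_add (hγ : IsMaximalSolution F D I γ) (a : ℝ) :
    IsMaximalSolution F D {t | t + a ∈ I} (fun t => γ (t + a)) where
  isSolution := hγ.isSolution.comp_add a
  maximal J δ hδ hJ heq := by
    have := hγ.maximal _ _ (hδ.comp_add (-a)) (fun t ht => hJ (by simpa using ht))
      (fun t ht => by
        have := heq (x := t + -a) (by simpa using ht)
        simpa using this)
    intro t ht
    exact this (by simpa using ht)

/-- Solutions of `ż = F z` in `D` through every point of `D` exist for short times. -/
def LocallySolvable (F : E → E) (D : Set E) : Prop :=
  ∀ z ∈ D, ∃ ε > 0, ∃ σ : ℝ → E, σ 0 = z ∧ IsSolution F D (Ioo (-ε) ε) σ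

/-- The maximal solution is the union of all solutions with value `z` at time 0. Uniqueness makes
the value at `t` independent of the solution chosen. -/
theorem LocallySolvable.exists_isMaximalSolution (hE : LocallySolvable F D)
    (hF : ∀ z ∈ D, ContDiffAt ℝ 1 F z) (hz : z ∈ D) :
    ∃ (I : Set ℝ) (γ : ℝ → E), IsMaximalSolution F D I γ ∧ (0 : ℝ) ∈ I ∧ γ 0 = z := by
  classical
  let P : ℝ → Set ℝ → (ℝ → E) → Prop := fun t J δ =>
    (IsSolution F D J δ ∧ (0 : ℝ) ∈ J ∧ δ 0 = z) ∧ t ∈ J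
  let γ : ℝ → E := fun t => if h : ∃ J δ, P t J δ then h.choose_spec.choose t else z
  let I : Set ℝ := {t | ∃ J δ, P t J δ}
  have sub : ∀ {J δ}, IsSolution F D J δ → (0 : ℝ) ∈ J → δ 0 = z → J ⊆ I :=
    fun h1 h2 h3 t ht => ⟨_, _, ⟨h1, h2, h3⟩, ht⟩
  have key : ∀ {J δ}, IsSolution F D J δ → (0 : ℝ) ∈ J → δ 0 = z → EqOn γ δ J := by
    intro J δ hδ h0 h0z t ht
    have h : ∃ J δ, P t J δ := ⟨J, δ, ⟨hδ, h0, h0z⟩, ht⟩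
    have hsp : P t h.choose h.choose_spec.choose := h.choose_spec.choose_spec
    have : γ t = h.choose_spec.choose t := dif_pos h
    rw [this]
    exact hsp.1.1.eqOn hF hδ hsp.1.2.1 h0 (hsp.1.2.2.trans h0z.symm) ⟨hsp.2, ht⟩
  obtain ⟨ε, hε, σ, hσ0, hσ⟩ := hE z hz
  have h0σ : (0 : ℝ) ∈ Ioo (-ε) ε := ⟨by linarith, hε⟩
  have h0 : (0 : ℝ) ∈ I := sub hσ h0σ hσ0 h0σ
  have hγ0 : γ 0 = z := (key hσ h0σ hσ0 h0σ).trans hσ0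
  have hI : I = ⋃₀ {J | ∃ δ, IsSolution F D J δ ∧ (0 : ℝ) ∈ J ∧ δ 0 = z} := by
    ext t
    exact ⟨fun ⟨J, δ, h, ht⟩ => ⟨J, ⟨δ, h⟩, ht⟩, fun ⟨J, ⟨δ, h⟩, ht⟩ => ⟨J, δ, h, ht⟩⟩
  refine ⟨I, γ, ⟨⟨?_, ?_, ⟨0, h0⟩, ?_, ?_⟩, ?_⟩, h0, hγ0⟩
  · rw [hI]
    exact isOpen_sUnion fun J ⟨δ, h, _⟩ => h.isOpen
  · rw [hI]
    refine (isPreconnected_sUnion 0 _ ?_ ?_).ordConnected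
    · rintro J ⟨δ, h⟩
      exact h.2.1
    · rintro J ⟨δ, h⟩
      exact h.1.ordConnected.isPreconnected
  · rintro t ⟨J, δ, ⟨h1, h2, h3⟩, ht⟩
    rw [key h1 h2 h3 ht]
    exact h1.mem t ht
  · rintro t ⟨J, δ, ⟨h1, h2, h3⟩, ht⟩
    rw [key h1 h2 h3 ht]
    exact (h1.hasDerivAt t ht).congr_of_eventuallyEq
      ((key h1 h2 h3).eventuallyEq_of_mem (h1.isOpen.mem_nhds ht))
  · intro J δ hδ hIJ heq
    exact sub hδ (hIJ h0) ((heq h0).symm.trans hγ0)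

/-- A maximal solution that takes the same value twice is periodic. -/
theorem IsMaximalSolution.isPeriodicSolution (hF : ∀ z ∈ D, ContDiffAt ℝ 1 F z)
    (hγ : IsMaximalSolution F D I γ) {t s : ℝ} (ht : t ∈ I) (hs : s ∈ I) (hts : t < s)
    (h : γ t = γ s) : IsPeriodicSolution I γ := by
  set p := s - t
  have hp : 0 < p := sub_pos.2 hts
  have hδ := hγ.comp_add p
  have htJ : t ∈ {u | u + p ∈ I} := by simpa [p] using hs
  have h' : γ t = γ (t + p) := by simpa [p] using h
  -- The shift of `γ` by `p` is again maximal and meets `γ` at time `t`, so both have the same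
  -- domain. Hence `I` is invariant under translation by `±p`.
  have sub1 := hγ.subset_of_eq hF hδ.isSolution ht htJ h'
  have sub2 := hδ.subset_of_eq hF hγ.isSolution htJ ht h'.symm
  have eq1 := hγ.eqOn_of_eq hF hδ.isSolution ht htJ h'
  have up : ∀ n : ℕ, t + n * p ∈ I := by
    intro n
    induction n with
    | zero => simpa using ht
    | succ n ih =>
      have := sub2 ih
      simp only [mem_ofPred_eq] at this
      push_cast
      rwa [add_mul, one_mul, ← add_assoc]
  have down : ∀ n : ℕ, t - n * p ∈ I := by
    intro n
    induction n with
    | zero => simpa using ht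
    | succ n ih =>
      refine sub1 ?_
      simp only [mem_ofPred_eq]
      push_cast
      convert ih using 1
      ring
  have hI : I = univ := by
    refine eq_univ_of_forall fun u => ?_
    obtain ⟨n, hn⟩ := exists_nat_ge (|u - t| / p)
    rw [div_le_iff₀ hp] at hn
    exact hγ.isSolution.ordConnected.out (down n) (up n)
      ⟨by linarith [neg_abs_le (u - t)], by linarith [le_abs_self (u - t)]⟩
  refine ⟨hI, p, hp, fun u => ?_⟩
  exact (eq1 (x := u) (by simp [hI])).symm

theorem isSolution_const (hz : z ∈ D) (h : F z = 0) : IsSolution F D univ (fun _ => z) :=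
  ⟨isOpen_univ, ordConnected_univ, univ_nonempty, fun _ _ => hz,
    fun t _ => by simpa [h] using hasDerivAt_const t z⟩

theorem IsSolution.ne_zero (hF : ∀ z ∈ D, ContDiffAt ℝ 1 F z) (hγ : IsSolution F D I γ)
    (hn : IsNonstationary F I γ) {t : ℝ} (ht : t ∈ I) : F (γ t) ≠ 0 := by
  intro h0
  obtain ⟨s, hs, hs0⟩ := hn
  refine hs0 ?_
  rw [hγ.eqOn hF (isSolution_const (hγ.mem t ht) h0) ht (mem_univ t) rfl ⟨hs, mem_univ s⟩, h0]

/-- Near `z`, the set `L` is swept out by a short solution through `z`. -/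
def IsLocalArc (F : E → E) (D L : Set E) (z : E) : Prop :=
  ∃ ε > 0, ∃ σ : ℝ → E, σ 0 = z ∧ IsSolution F D (Ioo (-ε) ε) σ ∧
    ∀ η > 0, σ '' (Ioo (-ε) ε ∩ Ioo (-η) η) ∈ 𝓝[L] z

/-- Solutions reaching a point of a local arc follow the arc. -/
theorem IsMaximalSolution.follow_arc (hF : ∀ z ∈ D, ContDiffAt ℝ 1 F z)
    (hγ : IsMaximalSolution F D I γ) {ε : ℝ} {σ : ℝ → E} (hσ : IsSolution F D (Ioo (-ε) ε) σ)
    {t s : ℝ} (ht : t ∈ I) (hs : s ∈ Ioo (-ε) ε) (h : γ t = σ s) :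
    ∀ u ∈ Ioo (-ε) ε, u + (t - s) ∈ I ∧ γ (u + (t - s)) = σ u := by
  intro u hu
  have hγ' := hγ.comp_add (t - s)
  have hs' : s ∈ {u | u + (t - s) ∈ I} := by simpa using ht
  have h' : γ (s + (t - s)) = σ s := by simpa using h
  exact ⟨hγ'.subset_of_eq hF hσ hs' hs h' hu, hγ'.eqOn_of_eq hF hσ hs' hs h' hu⟩

theorem IsMaximalSolution.image_mem_nhdsWithin (hF : ∀ z ∈ D, ContDiffAt ℝ 1 F z)
    (hγ : IsMaximalSolution F D I γ) {t : ℝ} (ht : t ∈ I) (hL : IsLocalArc F D L (γ t)) :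
    γ '' I ∈ 𝓝[L] (γ t) := by
  obtain ⟨ε, hε, σ, hσ0, hσ, hn⟩ := hL
  refine mem_of_superset (hn ε hε) ?_
  rw [inter_self]
  rintro _ ⟨u, hu, rfl⟩
  obtain ⟨h1, h2⟩ := hγ.follow_arc hF hσ ht (s := 0) ⟨by linarith, hε⟩ hσ0.symm u hu
  exact ⟨_, h1, h2⟩

/-- The solution comes close enough to `z` to meet the arc through `z`, and then follows it through
`z` itself. -/
theorem IsMaximalSolution.mem_image_of_mem_closure (hF : ∀ z ∈ D, ContDiffAt ℝ 1 F z)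
    (hγ : IsMaximalSolution F D I γ) (hγL : γ '' I ⊆ L) (hL : IsLocalArc F D L z)
    (hz : z ∈ closure (γ '' I)) : z ∈ γ '' I := by
  obtain ⟨ε, hε, σ, hσ0, hσ, hn⟩ := hL
  have hz' : ∃ᶠ x in 𝓝[L] z, x ∈ γ '' I := by
    rw [frequently_nhdsWithin_iff]
    exact (mem_closure_iff_frequently.1 hz).mono fun x hx => ⟨hx, hγL hx⟩
  obtain ⟨_, ⟨t, ht, rfl⟩, s, ⟨hs, -⟩, hst⟩ := (hz'.and_eventually (hn ε hε)).exists
  obtain ⟨h1, h2⟩ := hγ.follow_arc hF hσ ht hs hst.symm 0 ⟨by linarith, hε⟩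
  exact ⟨_, h1, h2.trans hσ0⟩

/-- The solution meets the arc through `z` at arbitrarily late times, and each visit passes through
`z`. Two passages at different times force periodicity. -/
theorem IsMaximalSolution.isPeriodicSolution_of_mem_forwardLimitSet
    (hF : ∀ z ∈ D, ContDiffAt ℝ 1 F z) (hγ : IsMaximalSolution F D I γ) (hγL : γ '' I ⊆ L)
    (hL : IsLocalArc F D L z) (hz : z ∈ forwardLimitSet I γ) : IsPeriodicSolution I γ := by
  obtain ⟨ε, hε, σ, hσ0, hσ, hn⟩ := hL
  have h0 : (0 : ℝ) ∈ Ioo (-ε) ε := ⟨by linarith, hε⟩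
  have visit : ∀ t ∈ I, ∃ u ≥ t, ∃ s, s < ε / 2 ∧
      ∀ v ∈ Ioo (-ε) ε, v + (u - s) ∈ I ∧ γ (v + (u - s)) = σ v := by
    intro t ht
    have hz' : ∃ᶠ x in 𝓝[L] z, x ∈ γ '' (I ∩ Ici t) := by
      rw [frequently_nhdsWithin_iff]
      exact (mem_closure_iff_frequently.1 (mem_iInter₂.1 hz t ht)).mono
        fun x hx => ⟨hx, hγL (image_mono inter_subset_left hx)⟩
    obtain ⟨_, ⟨u, ⟨hu, htu⟩, rfl⟩, s, ⟨hs, hs'⟩, hst⟩ :=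
      (hz'.and_eventually (hn (ε / 2) (by linarith))).exists
    exact ⟨u, htu, s, hs'.2, hγ.follow_arc hF hσ hu hs hst.symm⟩
  obtain ⟨t, ht⟩ := hγ.isSolution.nonempty
  obtain ⟨u, -, s, -, hus⟩ := visit t ht
  have h1 := hus 0 h0
  -- Passages through `z` happen at times `u - s` and `u' - s'`. Since `u' ≥ ε / 2 + (u - s)` and
  -- `s' < ε / 2`, the second is strictly later.
  obtain ⟨u', hu', s', hs', hus'⟩ := visit _ (hus (ε / 2) ⟨by linarith, by linarith⟩).1
  have h2 := hus' 0 h0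
  exact hγ.isPeriodicSolution hF h1.1 h2.1 (by linarith) (h1.2.trans h2.2.symm)

theorem IsMaximalSolution.isPeriodicSolution_of_mem_backwardLimitSet
    (hF : ∀ z ∈ D, ContDiffAt ℝ 1 F z) (hγ : IsMaximalSolution F D I γ) (hγL : γ '' I ⊆ L)
    (hL : IsLocalArc F D L z) (hz : z ∈ backwardLimitSet I γ) : IsPeriodicSolution I γ := by
  obtain ⟨ε, hε, σ, hσ0, hσ, hn⟩ := hL
  have h0 : (0 : ℝ) ∈ Ioo (-ε) ε := ⟨by linarith, hε⟩
  have visit : ∀ t ∈ I, ∃ u ≤ t, ∃ s, -(ε / 2) < s ∧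
      ∀ v ∈ Ioo (-ε) ε, v + (u - s) ∈ I ∧ γ (v + (u - s)) = σ v := by
    intro t ht
    have hz' : ∃ᶠ x in 𝓝[L] z, x ∈ γ '' (I ∩ Iic t) := by
      rw [frequently_nhdsWithin_iff]
      exact (mem_closure_iff_frequently.1 (mem_iInter₂.1 hz t ht)).mono
        fun x hx => ⟨hx, hγL (image_mono inter_subset_left hx)⟩
    obtain ⟨_, ⟨u, ⟨hu, htu⟩, rfl⟩, s, ⟨hs, hs'⟩, hst⟩ :=
      (hz'.and_eventually (hn (ε / 2) (by linarith))).exists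
    exact ⟨u, htu, s, hs'.1, hγ.follow_arc hF hσ hu hs hst.symm⟩
  obtain ⟨t, ht⟩ := hγ.isSolution.nonempty
  obtain ⟨u, -, s, -, hus⟩ := visit t ht
  have h1 := hus 0 h0
  obtain ⟨u', hu', s', hs', hus'⟩ := visit _ (hus (-(ε / 2)) ⟨by linarith, by linarith⟩).1
  have h2 := hus' 0 h0
  exact hγ.isPeriodicSolution hF h2.1 h1.1 (by linarith) (h2.2.trans h1.2.symm)

/-- A solution that consists of local arcs of `L` and is closed in `L` is a component of `L`. -/
theorem IsMaximalSolution.connectedComponentIn_eq (hF : ∀ z ∈ D, ContDiffAt ℝ 1 F z)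
    (hγ : IsMaximalSolution F D I γ) (hγL : γ '' I ⊆ L) (hL : ∀ t ∈ I, IsLocalArc F D L (γ t))
    (hcl : closure (γ '' I) ∩ L ⊆ γ '' I) {t : ℝ} (ht : t ∈ I) :
    connectedComponentIn L (γ t) = γ '' I := by
  have htL : γ t ∈ L := hγL ⟨t, ht, rfl⟩
  refine Subset.antisymm ?_
    (hγ.isSolution.isPreconnected_image.subset_connectedComponentIn ⟨t, ht, rfl⟩ hγL)
  -- Closedness is `hcl`; openness holds because the trajectory fills a neighbourhood in `L` of each
  -- of its points.
  have hclopen : IsClopen ((↑) ⁻¹' (γ '' I) : Set L) := by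
    constructor
    · refine isClosed_of_closure_subset fun x hx => hcl ⟨?_, x.2⟩
      exact closure_mono (image_preimage_subset _ _) (closure_subtype.1 hx)
    · rw [isOpen_iff_mem_nhds]
      rintro ⟨x, hxL⟩ ⟨u, hu, rfl⟩
      exact preimage_coe_mem_nhds_subtype.2 (hγ.image_mem_nhdsWithin hF hu (hL u hu))
  rw [connectedComponentIn_eq_image htL, image_subset_iff]
  exact hclopen.connectedComponent_subset ⟨t, ht, rfl⟩

theorem IsMaximalSolution.isCompact_image (hγ : IsMaximalSolution F D I γ)
    (hp : IsPeriodicSolution I γ) : IsCompact (γ '' I) := by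
  obtain ⟨rfl, p, hp, hper⟩ := hp
  rw [image_univ]
  exact hper.compact_of_continuous hp.ne' (continuousOn_univ.1 hγ.isSolution.continuousOn)

/-- A solution in a smooth curve is a local arc of the curve at every nonstationary point. -/
theorem IsSmoothCurveAt.isLocalArc {F : (Fin 3 → ℝ) → (Fin 3 → ℝ)} {D L : Set (Fin 3 → ℝ)}
    {z : Fin 3 → ℝ} (h : IsSmoothCurveAt L z) (hF : ContinuousAt F z) (hz : F z ≠ 0) {ε : ℝ}
    (hε : 0 < ε) {σ : ℝ → (Fin 3 → ℝ)} (hσ0 : σ 0 = z) (hσ : IsSolution F D (Ioo (-ε) ε) σ)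
    (hσL : ∀ t ∈ Ioo (-ε) ε, σ t ∈ L) : IsLocalArc F D L z := by
  obtain ⟨Φ, hzΦ, hΦ, hΦ', hΦL⟩ := h
  refine ⟨ε, hε, σ, hσ0, hσ, fun η hη => ?_⟩
  have hIoo : Ioo (-ε) ε ∈ 𝓝 (0 : ℝ) := Ioo_mem_nhds (by linarith) hε
  have h0 : (0 : ℝ) ∈ Ioo (-ε) ε := ⟨by linarith, hε⟩
  have hσs : HasStrictDerivAt σ (F z) 0 := by
    have := hasStrictDerivAt_of_hasDerivAt_of_continuousAt (f := σ) (f' := fun t => F (σ t))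
      (x := 0) (by filter_upwards [hIoo] with t ht using hσ.hasDerivAt t ht)
      (ContinuousAt.comp (by rw [hσ0]; exact hF) (hσ.continuousAt h0))
    simpa [hσ0] using this
  have hsrc : Φ.source ∈ 𝓝 z := Φ.open_source.mem_nhds hzΦ
  have hΦs : HasStrictFDerivAt Φ (fderiv ℝ Φ z) z :=
    (hΦ.contDiffAt hsrc).hasStrictFDerivAt (by simp)
  have hinj : fderiv ℝ Φ z (F z) ≠ 0 := by
    intro h0
    have hsymm : HasFDerivAt Φ.symm (fderiv ℝ Φ.symm (Φ z)) (Φ z) :=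
      ((hΦ'.contDiffAt (Φ.open_target.mem_nhds (Φ.map_source hzΦ))).differentiableAt
        (by simp)).hasFDerivAt
    have hid : HasFDerivAt (Φ.symm ∘ Φ) ((fderiv ℝ Φ.symm (Φ z)).comp (fderiv ℝ Φ z)) z :=
      hsymm.comp z hΦs.hasFDerivAt
    have hid' : HasFDerivAt (Φ.symm ∘ Φ) (ContinuousLinearMap.id ℝ _) z :=
      (hasFDerivAt_id z).congr_of_eventuallyEq (by
        filter_upwards [hsrc] with x hx using Φ.left_inv hx)
    have := congrArg (fun A => A (F z)) (hid.unique hid')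
    simp [h0] at this
    exact hz this.symm
  have hΦσ : HasStrictDerivAt (fun t => Φ (σ t)) (fderiv ℝ Φ z (F z)) 0 := by
    rw [← hσ0] at hΦs
    have := hΦs.comp_hasStrictDerivAt 0 hσs
    rwa [hσ0] at this
  have hcomp : ∀ i, HasStrictDerivAt (fun t => Φ (σ t) i) (fderiv ℝ Φ z (F z) i) 0 :=
    hasStrictDerivAt_pi.1 hΦσ
  have hev : ∀ᶠ t in 𝓝 (0 : ℝ), σ t ∈ Φ.source ∧ t ∈ Ioo (-ε) ε ∩ Ioo (-η) η := by
    filter_upwards [hIoo, Ioo_mem_nhds (by linarith : -η < 0) hη,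
      (hσ.continuousAt h0).preimage_mem_nhds (by rw [hσ0]; exact hsrc)] with t h1 h2 h3
    exact ⟨h3, h1, h2⟩
  -- As `σ` stays in `L`, the last two chart coordinates vanish along it, so only the first can
  -- carry the nonzero velocity.
  have hzero : ∀ i : Fin 3, i ≠ 0 → fderiv ℝ Φ z (F z) i = 0 := by
    intro i hi
    refine (hcomp i).hasDerivAt.unique ((hasDerivAt_const (0 : ℝ) (0 : ℝ)).congr_of_eventuallyEq ?_)
    filter_upwards [hev] with t ht
    have := (hΦL _ ht.1).1 (hσL t ht.2.1)
    fin_cases i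
    · exact absurd rfl hi
    · exact this.1
    · exact this.2
  have hne : fderiv ℝ Φ z (F z) 0 ≠ 0 := by
    intro h0
    refine hinj (funext fun i => ?_)
    by_cases hi : i = 0
    · simpa [hi] using h0
    · exact hzero i hi
  -- A nonzero strict derivative makes the first chart coordinate along `σ` open at time 0, so it
  -- covers a whole neighbourhood on the axis.
  have himg : (fun t => Φ (σ t) 0) '' {t | σ t ∈ Φ.source ∧ t ∈ Ioo (-ε) ε ∩ Ioo (-η) η} ∈
      𝓝 (Φ z 0) := by
    have := (hcomp 0).map_nhds_eq hne
    simp only [hσ0] at this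
    rw [← this]
    exact image_mem_map hev
  have hcont : ContinuousAt (fun x => Φ x 0) z :=
    (continuous_apply 0).continuousAt.comp (Φ.continuousAt hzΦ)
  filter_upwards [self_mem_nhdsWithin, mem_nhdsWithin_of_mem_nhds hsrc,
    mem_nhdsWithin_of_mem_nhds (hcont.preimage_mem_nhds himg)] with x hxL hxs hx
  obtain ⟨t, ⟨hts, htη⟩, htx⟩ := hx
  refine ⟨t, htη, ?_⟩
  have h1 := (hΦL _ hxs).1 hxL
  have h2 := (hΦL _ hts).1 (hσL t htη.1)
  refine Φ.injOn hts hxs (funext fun i => ?_)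
  fin_cases i
  · exact htx
  · exact h2.1.trans h1.1.symm
  · exact h2.2.trans h1.2.symm

end Flow

/-! ### The reduced system and its phase space -/

section ReducedSystem

open Filter Topology

variable {U : RatFunc ℝ} {w : Fin 3 → ℝ} {I : Set ℝ} {γ : ℝ → (Fin 3 → ℝ)}

theorem isOpen_regularArgs (U : RatFunc ℝ) : IsOpen (regularArgs U) :=
  isOpen_ne_fun U.denom.continuous continuous_const

theorem ratFun_eq_div (U : RatFunc ℝ) :
    ratFun U = fun r => U.num.eval r / U.denom.eval r := by
  funext r
  simp [ratFun, RatFunc.eval, Polynomial.eval₂_id]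

theorem contDiffOn_ratFun (U : RatFunc ℝ) :
    ContDiffOn ℝ (⊤ : ℕ∞) (ratFun U) (regularArgs U) := by
  rw [ratFun_eq_div]
  have h (p : Polynomial ℝ) : ContDiff ℝ (⊤ : ℕ∞) fun r => p.eval r := by
    simpa using p.contDiff_aeval (𝕜 := ℝ) (⊤ : ℕ∞)
  exact (h _).contDiffOn.div (h _).contDiffOn fun r hr => hr

theorem contDiffOn_deriv_ratFun (U : RatFunc ℝ) :
    ContDiffOn ℝ (⊤ : ℕ∞) (deriv (ratFun U)) (regularArgs U) :=
  (contDiffOn_ratFun U).deriv_of_isOpen (isOpen_regularArgs U) (by simp)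

theorem hasDerivAt_ratFun {r : ℝ} (hr : r ∈ regularArgs U) :
    HasDerivAt (ratFun U) (deriv (ratFun U) r) r :=
  (((contDiffOn_ratFun U).contDiffAt ((isOpen_regularArgs U).mem_nhds hr)).differentiableAt
    (by simp)).hasDerivAt

theorem isOpen_setOf_apply_mem_regularArgs (U : RatFunc ℝ) :
    IsOpen {w : Fin 3 → ℝ | w 0 ∈ regularArgs U} :=
  (isOpen_regularArgs U).preimage (continuous_apply 0)

theorem contDiffAt_reducedField (hw : w 0 ∈ regularArgs U) :
    ContDiffAt ℝ (⊤ : ℕ∞) (reducedField U) w := by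
  have h0 : ContDiffAt ℝ (⊤ : ℕ∞) (fun z : Fin 3 → ℝ => deriv (ratFun U) (z 0)) w :=
    ((contDiffOn_deriv_ratFun U).contDiffAt ((isOpen_regularArgs U).mem_nhds hw)).comp w
      (contDiff_apply ℝ ℝ 0).contDiffAt
  have h (i : Fin 3) : ContDiffAt ℝ (⊤ : ℕ∞) (fun z : Fin 3 → ℝ => z i) w :=
    (contDiff_apply ℝ ℝ i).contDiffAt
  rw [contDiffAt_pi]
  intro i
  fin_cases i
  · exact h 1
  · exact ((h 0).mul (h 2)).sub (((h 0).pow 2).mul h0)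
  · exact (contDiffAt_const.mul (h 1)).mul h0

theorem contDiffAt_one_reducedField :
    ∀ z ∈ {w : Fin 3 → ℝ | w 0 ∈ regularArgs U}, ContDiffAt ℝ 1 (reducedField U) z :=
  fun _ hz => (contDiffAt_reducedField hz).of_le (by exact_mod_cast le_top)

/-! ### The fibres of the reduction map -/

/-- The point with first coordinate `s` in the fibre over `(a, b, (j² + b²) / a²)` on which
the momentum of the parabolic rotations is `j`. -/
noncomputable def fiberPoint (a b j s : ℝ) : (Fin 3 → ℝ) × (Fin 3 → ℝ) :=
  (![s, (a - (1 + s ^ 2) / a) / 2, (-a - (1 + s ^ 2) / a) / 2],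
   ![(j + s * b) / a, ((-2 * s * j - s ^ 2 * b + b) / a ^ 2 + b) / 2,
    ((-2 * s * j - s ^ 2 * b + b) / a ^ 2 - b) / 2])

/-- The momentum of the parabolic rotations. -/
def parabolicMomentum (p : (Fin 3 → ℝ) × (Fin 3 → ℝ)) : ℝ :=
  (p.1 1 - p.1 2) * p.2 0 - p.1 0 * (p.2 1 - p.2 2)

theorem reductionMap_fiberPoint {a : ℝ} (ha : a ≠ 0) (b j s : ℝ) :
    reductionMap (fiberPoint a b j s) = ![a, b, (j ^ 2 + b ^ 2) / a ^ 2] := by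
  funext i
  fin_cases i
  · simp [reductionMap, fiberPoint]; ring
  · simp [reductionMap, fiberPoint]; ring
  · simp [reductionMap, fiberPoint, lorentz]; field_simp; ring

theorem parabolicMomentum_fiberPoint {a : ℝ} (ha : a ≠ 0) (b j s : ℝ) :
    parabolicMomentum (fiberPoint a b j s) = j := by
  simp [parabolicMomentum, fiberPoint]; field_simp; ring

theorem fiberPoint_mem_phaseSpace {a : ℝ} (ha : a < 0) (hr : a ∈ regularArgs U) (b j s : ℝ) :
    fiberPoint a b j s ∈ phaseSpace U := by
  have ha' := ha.ne
  refine ⟨⟨?_, ?_, ?_⟩, ?_⟩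
  · simp [fiberPoint, lorentz]; field_simp; ring
  · have : 0 < -((1 + s ^ 2) / a) := by
      rw [← div_neg]
      exact div_pos (by positivity) (by linarith)
    simp only [fiberPoint, Matrix.cons_val]
    linarith
  · simp [fiberPoint, lorentz]; field_simp; ring
  · convert hr using 1
    simp [fiberPoint]; ring

/-- This follows from (x₂ - x₃)(x₂ + x₃) = -(1 + x₁²) < 0 and x₃ > 0. -/
theorem reductionMap_zero_neg {p : (Fin 3 → ℝ) × (Fin 3 → ℝ)} (hp : p ∈ tangentHyperbolicPlane) :
    p.1 1 - p.1 2 < 0 := by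
  obtain ⟨h1, h2, -⟩ := hp
  simp only [lorentz] at h1
  nlinarith [sq_nonneg (p.1 0)]

/-- The hyperboloid equation gives x₂ + x₃, the momentum gives y₁, and then ⟨x, y⟩_L = 0 gives y₂ +
y₃. -/
theorem eq_fiberPoint {p : (Fin 3 → ℝ) × (Fin 3 → ℝ)} (hp : p ∈ tangentHyperbolicPlane) :
    p = fiberPoint (p.1 1 - p.1 2) (p.2 1 - p.2 2) (parabolicMomentum p) (p.1 0) := by
  have ha := (reductionMap_zero_neg hp).ne
  obtain ⟨h1, -, h3⟩ := hp
  obtain ⟨x, y⟩ := p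
  simp only [lorentz, fiberPoint, parabolicMomentum] at *
  have hb : -(1 + x 0 ^ 2) / (x 1 - x 2) = x 1 + x 2 := by
    rw [div_eq_iff ha]; linarith
  have hy0 : ((x 1 - x 2) * y 0 - x 0 * (y 1 - y 2) + x 0 * (y 1 - y 2)) / (x 1 - x 2) = y 0 := by
    rw [div_eq_iff ha]; ring
  have hb' : (-2 * x 0 * ((x 1 - x 2) * y 0 - x 0 * (y 1 - y 2)) - x 0 ^ 2 * (y 1 - y 2) +
      (y 1 - y 2)) / (x 1 - x 2) ^ 2 = y 1 + y 2 := by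
    rw [div_eq_iff (pow_ne_zero 2 ha)]
    linear_combination (y 1 - y 2) * h1 - 2 * (x 1 - x 2) * h3
  refine Prod.ext (funext fun i => ?_) (funext fun i => ?_)
  · fin_cases i
    · rfl
    · simp only [Fin.mk_one, Matrix.cons_val]; rw [neg_div] at hb; linarith
    · simp only [Fin.reduceFinMk, Matrix.cons_val]; rw [neg_div] at hb; linarith
  · fin_cases i
    · exact hy0.symm
    · simp only [Fin.mk_one, Matrix.cons_val]; linarith
    · simp only [Fin.reduceFinMk, Matrix.cons_val]; linarith

theorem jSq_reductionMap {p : (Fin 3 → ℝ) × (Fin 3 → ℝ)} (hp : p ∈ tangentHyperbolicPlane) :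
    jSq (reductionMap p) = parabolicMomentum p ^ 2 := by
  have ha := (reductionMap_zero_neg hp).ne
  conv_lhs => rw [eq_fiberPoint hp, reductionMap_fiberPoint ha]
  simp [jSq]
  field_simp
  ring

theorem mem_reducedSpace_iff :
    w ∈ reducedSpace U ↔ w 0 < 0 ∧ w 0 ∈ regularArgs U ∧ 0 ≤ jSq w := by
  constructor
  · rintro ⟨p, ⟨hp, hr⟩, rfl⟩
    refine ⟨reductionMap_zero_neg hp, hr, ?_⟩
    rw [jSq_reductionMap hp]
    positivity
  · rintro ⟨h0, hr, hj⟩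
    refine ⟨fiberPoint (w 0) (w 1) (√(jSq w)) 0, fiberPoint_mem_phaseSpace h0 hr _ _ _, ?_⟩
    rw [reductionMap_fiberPoint h0.ne, Real.sq_sqrt hj]
    have h0' := h0.ne
    funext i
    fin_cases i
    · rfl
    · rfl
    · simp [jSq]; field_simp

theorem reducedSpace_subset (U : RatFunc ℝ) :
    reducedSpace U ⊆ {w : Fin 3 → ℝ | w 0 ∈ regularArgs U} :=
  fun _ hw => (mem_reducedSpace_iff.1 hw).2.1

theorem contDiffAt_reducedField_of_mem :
    ∀ z ∈ reducedSpace U, ContDiffAt ℝ 1 (reducedField U) z :=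
  fun _ hz => contDiffAt_one_reducedField _ (reducedSpace_subset U hz)

theorem mem_levelSet_iff {c₁ c₂ : ℝ} (hc : 0 ≤ c₁) :
    w ∈ levelSet U c₁ c₂ ↔
      w 0 < 0 ∧ w 0 ∈ regularArgs U ∧ jSq w = c₁ ∧ redHam U w = c₂ := by
  constructor
  · rintro ⟨h, h1, h2⟩
    obtain ⟨h3, h4, -⟩ := mem_reducedSpace_iff.1 h
    exact ⟨h3, h4, h1, h2⟩
  · rintro ⟨h1, h2, h3, h4⟩
    exact ⟨mem_reducedSpace_iff.2 ⟨h1, h2, h3 ▸ hc⟩, h3, h4⟩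

/-! ### The first integrals -/

/-- The derivative of `j²`. -/
noncomputable def jSqDeriv (w : Fin 3 → ℝ) : (Fin 3 → ℝ) →L[ℝ] ℝ :=
  (2 * w 0 * w 2) • ContinuousLinearMap.proj 0 + (-2 * w 1) • ContinuousLinearMap.proj 1 +
    (w 0 ^ 2) • ContinuousLinearMap.proj 2

/-- The derivative of the reduced Hamiltonian. -/
noncomputable def redHamDeriv (U : RatFunc ℝ) (w : Fin 3 → ℝ) : (Fin 3 → ℝ) →L[ℝ] ℝ :=
  (deriv (ratFun U) (w 0)) • ContinuousLinearMap.proj 0 +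
    (1 / 2 : ℝ) • ContinuousLinearMap.proj 2

theorem jSqDeriv_apply (w v : Fin 3 → ℝ) :
    jSqDeriv w v = 2 * w 0 * w 2 * v 0 + -2 * w 1 * v 1 + w 0 ^ 2 * v 2 := by
  simp [jSqDeriv]

theorem redHamDeriv_apply (w v : Fin 3 → ℝ) :
    redHamDeriv U w v = deriv (ratFun U) (w 0) * v 0 + 1 / 2 * v 2 := by
  simp [redHamDeriv]

theorem hasFDerivAt_jSq (w : Fin 3 → ℝ) : HasFDerivAt jSq (jSqDeriv w) w := by
  have h (i : Fin 3) : HasFDerivAt (fun z : Fin 3 → ℝ => z i) (ContinuousLinearMap.proj i) w :=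
    (ContinuousLinearMap.proj (R := ℝ) (φ := fun _ : Fin 3 => ℝ) i).hasFDerivAt
  refine ((((h 0).pow 2).mul (h 2)).sub ((h 1).pow 2)).congr_fderiv ?_
  ext v
  simp [jSqDeriv]
  ring

theorem hasFDerivAt_redHam (hw : w 0 ∈ regularArgs U) :
    HasFDerivAt (redHam U) (redHamDeriv U w) w := by
  have h (i : Fin 3) : HasFDerivAt (fun z : Fin 3 → ℝ => z i) (ContinuousLinearMap.proj i) w :=
    (ContinuousLinearMap.proj (R := ℝ) (φ := fun _ : Fin 3 => ℝ) i).hasFDerivAt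
  have h0 := HasDerivAt.comp_hasFDerivAt (f := fun z : Fin 3 → ℝ => z 0) w
    (hasDerivAt_ratFun hw) (h 0)
  refine (((h 2).mul_const (1 / 2 : ℝ)).add h0).congr_fderiv ?_ |>.congr_of_eventuallyEq ?_
  · ext v
    simp [redHamDeriv, add_comm]
  · refine .of_forall fun z => ?_
    simp [redHam]; ring

theorem jSqDeriv_reducedField : jSqDeriv w (reducedField U w) = 0 := by
  rw [jSqDeriv_apply]
  simp [reducedField]
  ring

theorem redHamDeriv_reducedField : redHamDeriv U w (reducedField U w) = 0 := by
  rw [redHamDeriv_apply]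
  simp [reducedField]
  ring

theorem IsSolution.jSq_eq {D : Set (Fin 3 → ℝ)} (h : IsSolution (reducedField U) D I γ) {t s : ℝ}
    (ht : t ∈ I) (hs : s ∈ I) : jSq (γ t) = jSq (γ s) := by
  have hd : ∀ u ∈ I, HasDerivAt (fun u => jSq (γ u)) 0 u := fun u hu => by
    have := (hasFDerivAt_jSq (γ u)).comp_hasDerivAt u (h.hasDerivAt u hu)
    rwa [jSqDeriv_reducedField] at this
  exact h.isOpen.is_const_of_deriv_eq_zero h.ordConnected.isPreconnected
    (fun u hu => (hd u hu).differentiableAt.differentiableWithinAt)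
    (fun u hu => (hd u hu).deriv) ht hs

theorem IsSolution.redHam_eq {D : Set (Fin 3 → ℝ)} (h : IsSolution (reducedField U) D I γ)
    (hD : D ⊆ {w | w 0 ∈ regularArgs U}) {t s : ℝ} (ht : t ∈ I) (hs : s ∈ I) :
    redHam U (γ t) = redHam U (γ s) := by
  have hd : ∀ u ∈ I, HasDerivAt (fun u => redHam U (γ u)) 0 u := fun u hu => by
    have := (hasFDerivAt_redHam (hD (h.mem u hu))).comp_hasDerivAt u (h.hasDerivAt u hu)
    rwa [redHamDeriv_reducedField] at this
  exact h.isOpen.is_const_of_deriv_eq_zero h.ordConnected.isPreconnected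
    (fun u hu => (hd u hu).differentiableAt.differentiableWithinAt)
    (fun u hu => (hd u hu).deriv) ht hs

theorem IsSolution.mem_levelSet (h : IsSolution (reducedField U) (reducedSpace U) I γ)
    {c₁ c₂ : ℝ} {t s : ℝ} (ht : t ∈ I) (htL : γ t ∈ levelSet U c₁ c₂) (hs : s ∈ I) :
    γ s ∈ levelSet U c₁ c₂ :=
  ⟨h.mem s hs, (h.jSq_eq hs ht).trans htL.2.1,
    (h.redHam_eq (reducedSpace_subset U) hs ht).trans htL.2.2⟩

/-- `reducedSpace U` need not be open, because of the condition j² ≥ 0. The solution is found in the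
open set given by the other two conditions; conservation of j² keeps it in `reducedSpace U`. -/
theorem locallySolvable_reducedField (U : RatFunc ℝ) :
    LocallySolvable (reducedField U) (reducedSpace U) := by
  intro z hz
  obtain ⟨h0, hr, hj⟩ := mem_reducedSpace_iff.1 hz
  obtain ⟨σ, hσ0, ε, hε, hσ⟩ := (contDiffAt_reducedField_of_mem z
    hz).exists_forall_mem_closedBall_exists_eq_forall_mem_Ioo_hasDerivAt₀ 0
  simp only [zero_sub, zero_add] at hσ
  have hopen : IsOpen {w : Fin 3 → ℝ | w 0 < 0 ∧ w 0 ∈ regularArgs U} :=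
    (isOpen_lt (continuous_apply 0) continuous_const).inter (isOpen_setOf_apply_mem_regularArgs U)
  have hc : ContinuousAt σ 0 := (hσ 0 ⟨by linarith, hε⟩).continuousAt
  obtain ⟨η, hη, hση⟩ := Metric.mem_nhds_iff.1
    (hc.preimage_mem_nhds (hopen.mem_nhds (by rw [hσ0]; exact ⟨h0, hr⟩)))
  rw [Real.ball_eq_Ioo, zero_sub, zero_add] at hση
  have hm : 0 < min ε η := lt_min hε hη
  have hm0 : (0 : ℝ) ∈ Ioo (-min ε η) (min ε η) := ⟨by linarith, hm⟩
  have sub : ∀ {ρ}, min ε η ≤ ρ → Ioo (-min ε η) (min ε η) ⊆ Ioo (-ρ) ρ :=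
    fun h => Ioo_subset_Ioo (neg_le_neg h) h
  have hsol : IsSolution (reducedField U) {w | w 0 < 0 ∧ w 0 ∈ regularArgs U}
      (Ioo (-min ε η) (min ε η)) σ :=
    ⟨isOpen_Ioo, ordConnected_Ioo, ⟨0, hm0⟩, fun t ht => hση (sub (min_le_right _ _) ht),
      fun t ht => hσ t (sub (min_le_left _ _) ht)⟩
  refine ⟨min ε η, hm, σ, hσ0, isOpen_Ioo, ordConnected_Ioo, ⟨0, hm0⟩, fun t ht => ?_,
    hsol.hasDerivAt⟩
  obtain ⟨h1, h2⟩ := hsol.mem t ht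
  refine mem_reducedSpace_iff.2 ⟨h1, h2, ?_⟩
  rw [hsol.jSq_eq ht hm0, hσ0]
  exact hj

/-! ### The level sets -/

/-- The derivative of the chart `w ↦ (w_k, j², h)`. -/
noncomputable def levelChartDeriv (U : RatFunc ℝ) (k : Fin 3) (w : Fin 3 → ℝ) :
    (Fin 3 → ℝ) →L[ℝ] (Fin 3 → ℝ) :=
  ContinuousLinearMap.pi ![ContinuousLinearMap.proj k, jSqDeriv w, redHamDeriv U w]

/-- The determinant of the chart derivative is e_k · (∇(j²) × ∇h), which is minus the `k`-th
component of the reduced field. -/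
theorem levelChartDeriv_injective {k : Fin 3} (hk : reducedField U w k ≠ 0) :
    Function.Injective (levelChartDeriv U k w) := by
  rw [injective_iff_map_eq_zero]
  intro v hv
  have hv0 : v k = 0 := congrFun hv 0
  have hv1 : jSqDeriv w v = 0 := congrFun hv 1
  have hv2 : redHamDeriv U w v = 0 := congrFun hv 2
  rw [jSqDeriv_apply] at hv1
  rw [redHamDeriv_apply] at hv2
  have hall : v 0 = 0 ∧ v 1 = 0 ∧ v 2 = 0 := by
    fin_cases k
    · simp only [Fin.zero_eta, reducedField, Matrix.cons_val_zero] at hv0 hk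
      rw [hv0] at hv1 hv2
      have h2 : v 2 = 0 := by linarith
      rw [h2] at hv1
      have h1 : w 1 * v 1 = 0 := by linarith
      exact ⟨hv0, (mul_eq_zero.1 h1).resolve_left hk, h2⟩
    · simp only [Fin.mk_one, reducedField, Matrix.cons_val_one, Matrix.cons_val_zero] at hv0 hk
      have h0 : (w 0 * w 2 - w 0 ^ 2 * deriv (ratFun U) (w 0)) * v 0 = 0 := by
        rw [hv0] at hv1
        linear_combination (1 / 2) * hv1 - w 0 ^ 2 * hv2
      have h0' := (mul_eq_zero.1 h0).resolve_left hk
      rw [h0'] at hv2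
      exact ⟨h0', hv0, by linarith⟩
    · simp only [Fin.reduceFinMk, reducedField, Matrix.cons_val] at hv0 hk
      rw [hv0] at hv1 hv2
      have hk1 := left_ne_zero_of_mul hk
      have h0 := (mul_eq_zero.1 (show deriv (ratFun U) (w 0) * v 0 = 0 by linarith)).resolve_left
        (right_ne_zero_of_mul hk)
      rw [h0] at hv1
      exact ⟨h0, (mul_eq_zero.1 (show -2 * w 1 * v 1 = 0 by linarith)).resolve_left hk1, hv0⟩
  funext i
  fin_cases i
  · exact hall.1
  · exact hall.2.1
  · exact hall.2.2

/-- The chart `w ↦ (w_k, j² - c₁, h - c₂)`. -/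
noncomputable def levelChart (U : RatFunc ℝ) (c₁ c₂ : ℝ) (k : Fin 3) (w : Fin 3 → ℝ) : Fin 3 → ℝ :=
  ![w k, jSq w - c₁, redHam U w - c₂]

theorem hasFDerivAt_levelChart (c₁ c₂ : ℝ) (k : Fin 3) (hw : w 0 ∈ regularArgs U) :
    HasFDerivAt (levelChart U c₁ c₂ k) (levelChartDeriv U k w) w := by
  rw [hasFDerivAt_pi']
  intro i
  fin_cases i
  · exact hasFDerivAt_apply k w
  · exact (hasFDerivAt_jSq w).sub_const c₁
  · exact (hasFDerivAt_redHam hw).sub_const c₂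

theorem contDiffAt_levelChart (c₁ c₂ : ℝ) (k : Fin 3) (hw : w 0 ∈ regularArgs U) :
    ContDiffAt ℝ (⊤ : ℕ∞) (levelChart U c₁ c₂ k) w := by
  have h (i : Fin 3) : ContDiffAt ℝ (⊤ : ℕ∞) (fun z : Fin 3 → ℝ => z i) w :=
    (contDiff_apply ℝ ℝ i).contDiffAt
  have h0 : ContDiffAt ℝ (⊤ : ℕ∞) (fun z : Fin 3 → ℝ => ratFun U (z 0)) w :=
    ContDiffAt.comp (g := ratFun U) w
      ((contDiffOn_ratFun U).contDiffAt ((isOpen_regularArgs U).mem_nhds hw)) (h 0)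
  rw [contDiffAt_pi]
  intro i
  fin_cases i
  · exact h k
  · exact ((((h 0).pow 2).mul (h 2)).sub ((h 1).pow 2)).sub contDiffAt_const
  · exact (((h 2).div_const 2).add h0).sub contDiffAt_const

/-- The derivative of the chart as an isomorphism. -/
noncomputable def levelChartEquiv {k : Fin 3} (hk : reducedField U w k ≠ 0) :
    (Fin 3 → ℝ) ≃L[ℝ] (Fin 3 → ℝ) :=
  (LinearEquiv.ofInjectiveEndo (levelChartDeriv U k w : (Fin 3 → ℝ) →ₗ[ℝ] (Fin 3 → ℝ))
    (levelChartDeriv_injective hk)).toContinuousLinearEquiv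

theorem coe_levelChartEquiv {k : Fin 3} (hk : reducedField U w k ≠ 0) :
    (levelChartEquiv hk : (Fin 3 → ℝ) →L[ℝ] (Fin 3 → ℝ)) = levelChartDeriv U k w := by
  ext v
  rfl

theorem surjective_fderiv_firstIntegrals (hw : w 0 ∈ regularArgs U) (hF : reducedField U w ≠ 0) :
    Function.Surjective (fderiv ℝ (fun z : Fin 3 → ℝ => (jSq z, redHam U z)) w) := by
  obtain ⟨k, hk⟩ := Function.ne_iff.1 hF
  rw [((hasFDerivAt_jSq w).prodMk (hasFDerivAt_redHam hw)).fderiv]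
  rintro ⟨a, b⟩
  obtain ⟨v, hv⟩ := (levelChartEquiv hk).surjective ![0, a, b]
  exact ⟨v, Prod.ext (congrFun hv 1) (congrFun hv 2)⟩

theorem isSmoothCurveAt_levelSet {c₁ c₂ : ℝ} (hc : 0 ≤ c₁) (hw : w ∈ levelSet U c₁ c₂)
    (hF : reducedField U w ≠ 0) : IsSmoothCurveAt (levelSet U c₁ c₂) w := by
  obtain ⟨h0, hr, -, -⟩ := (mem_levelSet_iff hc).1 hw
  obtain ⟨k, hk⟩ := Function.ne_iff.1 hF
  -- On this open set the level set is given by two equations only, and the chart derivative is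
  -- invertible at every point, which makes the inverse smooth on the whole target.
  have hW : IsOpen ({z : Fin 3 → ℝ | z 0 ∈ regularArgs U} ∩
      {z | z 0 < 0 ∧ reducedField U z k ≠ 0}) := by
    rw [isOpen_iff_mem_nhds]
    rintro z ⟨hzr, hz0, hzk⟩
    have hcont : ContinuousAt (fun z => reducedField U z k) z :=
      (continuous_apply k).continuousAt.comp (contDiffAt_reducedField hzr).continuousAt
    filter_upwards [(isOpen_setOf_apply_mem_regularArgs U).mem_nhds hzr,
      (isOpen_lt (continuous_apply 0) continuous_const).mem_nhds hz0,
      hcont.eventually_ne hzk] with y h1 h2 h3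
    exact ⟨h1, h2, h3⟩
  have hd : ∀ {z : Fin 3 → ℝ}, z 0 ∈ regularArgs U → ∀ hzk : reducedField U z k ≠ 0,
      HasFDerivAt (levelChart U c₁ c₂ k)
        (levelChartEquiv hzk : (Fin 3 → ℝ) →L[ℝ] (Fin 3 → ℝ)) z := by
    intro z hz hzk
    rw [coe_levelChartEquiv]
    exact hasFDerivAt_levelChart c₁ c₂ k hz
  let e := (contDiffAt_levelChart c₁ c₂ k hr).toOpenPartialHomeomorph (levelChart U c₁ c₂ k)
    (hd hr hk) (by simp)
  have he : w ∈ e.source := ContDiffAt.mem_toOpenPartialHomeomorph_source _ _ _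
  let Φ := e.restrOpen _ hW
  have hΦ : (Φ : (Fin 3 → ℝ) → (Fin 3 → ℝ)) = levelChart U c₁ c₂ k := rfl
  have hsrc : Φ.source = e.source ∩ ({z : Fin 3 → ℝ | z 0 ∈ regularArgs U} ∩
      {z | z 0 < 0 ∧ reducedField U z k ≠ 0}) := e.restrOpen_source _ hW
  refine ⟨Φ, ?_, ?_, ?_, ?_⟩
  · rw [hsrc]
    exact ⟨he, hr, h0, hk⟩
  · intro z hz
    rw [hsrc] at hz
    exact (contDiffAt_levelChart c₁ c₂ k hz.2.1).contDiffWithinAt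
  · intro y hy
    have hz := Φ.map_target hy
    rw [hsrc] at hz
    exact (Φ.contDiffAt_symm hy (hd hz.2.1 hz.2.2.2)
      (contDiffAt_levelChart c₁ c₂ k hz.2.1)).contDiffWithinAt
  · intro z hz
    rw [hsrc] at hz
    rw [mem_levelSet_iff hc, hΦ]
    simp only [levelChart, Matrix.cons_val, sub_eq_zero]
    exact ⟨fun h => h.2.2, fun h => ⟨hz.2.2.1, hz.2.1, h⟩⟩

theorem isLocalArc_levelSet {c₁ c₂ : ℝ} (hc : 0 ≤ c₁) (hw : w ∈ levelSet U c₁ c₂)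
    (hF : reducedField U w ≠ 0) :
    IsLocalArc (reducedField U) (reducedSpace U) (levelSet U c₁ c₂) w := by
  obtain ⟨ε, hε, σ, hσ0, hσ⟩ := locallySolvable_reducedField U w hw.1
  have h0 : (0 : ℝ) ∈ Ioo (-ε) ε := ⟨by linarith, hε⟩
  exact (isSmoothCurveAt_levelSet hc hw hF).isLocalArc
    (contDiffAt_reducedField_of_mem w hw.1).continuousAt hF hε hσ0 hσ
    fun t ht => hσ.mem_levelSet h0 (by rwa [hσ0]) ht

/-- Clearing the denominator in h = c₂ gives a closed condition that still makes sense at poles, and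
coprimality of numerator and denominator then excludes poles. On the remaining boundary w₁ = 0, the
equation -w₂² = c₁ ≥ 0 forces w₂ = 0. -/
theorem closure_levelSet_subset {c₁ c₂ : ℝ} (hc : 0 ≤ c₁) (hw : w ∈ closure (levelSet U c₁ c₂)) :
    w 0 ∈ regularArgs U ∧ (w ∈ levelSet U c₁ c₂ ∨ reducedField U w = 0) := by
  have hham : ∀ z : Fin 3 → ℝ, z 0 ∈ regularArgs U → (redHam U z = c₂ ↔
      U.denom.eval (z 0) * (z 2 / 2 - c₂) + U.num.eval (z 0) = 0) := by
    intro z hz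
    have hz' : U.denom.eval (z 0) ≠ 0 := hz
    rw [redHam, ratFun_eq_div]
    simp only
    field_simp
    constructor <;> intro h <;> linarith
  have hclosed : IsClosed {z : Fin 3 → ℝ | (z 0 ≤ 0 ∧ jSq z = c₁) ∧
      U.denom.eval (z 0) * (z 2 / 2 - c₂) + U.num.eval (z 0) = 0} := by
    have h (i : Fin 3) : Continuous fun z : Fin 3 → ℝ => z i := continuous_apply i
    refine ((isClosed_le (h 0) continuous_const).inter (isClosed_eq ?_ continuous_const)).inter
      (isClosed_eq ?_ continuous_const)
    · exact (((h 0).pow 2).mul (h 2)).sub ((h 1).pow 2)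
    · exact ((U.denom.continuous.comp (h 0)).mul (((h 2).div_const 2).sub continuous_const)).add
        (U.num.continuous.comp (h 0))
  have hsub : levelSet U c₁ c₂ ⊆ {z : Fin 3 → ℝ | (z 0 ≤ 0 ∧ jSq z = c₁) ∧
      U.denom.eval (z 0) * (z 2 / 2 - c₂) + U.num.eval (z 0) = 0} := by
    intro z hz
    obtain ⟨h1, h2, h3, h4⟩ := (mem_levelSet_iff hc).1 hz
    exact ⟨⟨h1.le, h3⟩, (hham z h2).1 h4⟩
  obtain ⟨⟨h0, hj⟩, hh⟩ := closure_minimal hsub hclosed hw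
  have hr : w 0 ∈ regularArgs U := by
    intro hden
    rw [hden, zero_mul, zero_add] at hh
    obtain ⟨a, b, hab⟩ := U.isCoprime_num_denom
    have := congrArg (Polynomial.eval (w 0)) hab
    simp [hden, hh] at this
  refine ⟨hr, ?_⟩
  rcases h0.lt_or_eq with h0 | h0
  · exact .inl ((mem_levelSet_iff hc).2 ⟨h0, hr, hj, (hham w hr).2 hh⟩)
  · right
    have h1 : w 1 = 0 := by
      rw [jSq, h0] at hj
      nlinarith
    funext i
    fin_cases i <;> simp [reducedField, h0, h1]

end ReducedSystem

/-! ### Projection of the motion to the reduced system -/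

section Motion

variable {U : RatFunc ℝ} {I : Set ℝ} {p : (Fin 3 → ℝ) × (Fin 3 → ℝ)}

theorem lorentzGrad_parabolicPotential {x : Fin 3 → ℝ} (hx : x 1 - x 2 ∈ regularArgs U) :
    lorentzGrad (parabolicPotential U) x =
      ![0, deriv (ratFun U) (x 1 - x 2), deriv (ratFun U) (x 1 - x 2)] := by
  have h (i : Fin 3) : HasFDerivAt (fun z : Fin 3 → ℝ => z i) (ContinuousLinearMap.proj i) x :=
    (ContinuousLinearMap.proj (R := ℝ) (φ := fun _ : Fin 3 => ℝ) i).hasFDerivAt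
  have hd := HasDerivAt.comp_hasFDerivAt (f := fun z : Fin 3 → ℝ => z 1 - z 2) x
    (hasDerivAt_ratFun hx) ((h 1).sub (h 2))
  have hf : fderiv ℝ (parabolicPotential U) x = _ := hd.fderiv
  funext i
  fin_cases i <;> simp [lorentzGrad, hf]

theorem motionField_apply (hp : p ∈ phaseSpace U) :
    motionField (parabolicPotential U) p =
      (p.2, -![0, deriv (ratFun U) (p.1 1 - p.1 2), deriv (ratFun U) (p.1 1 - p.1 2)] +
        (lorentz p.2 p.2 - (p.1 1 - p.1 2) * deriv (ratFun U) (p.1 1 - p.1 2)) • p.1) := by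
  rw [motionField, lorentzGrad_parabolicPotential hp.2]
  congr 3
  simp [lorentz]
  ring

/-- The derivative of the reduction map at `p` in the direction `m`. -/
def reductionMapDeriv (p m : (Fin 3 → ℝ) × (Fin 3 → ℝ)) : Fin 3 → ℝ :=
  ![m.1 1 - m.1 2, m.2 1 - m.2 2, 2 * lorentz p.2 m.2]

theorem reductionMapDeriv_motionField (hp : p ∈ phaseSpace U) :
    reductionMapDeriv p (motionField (parabolicPotential U) p) =
      reducedField U (reductionMap p) := by
  rw [motionField_apply hp]
  have h := hp.1.2.2
  rw [lorentz] at h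
  funext i
  fin_cases i
  · simp [reductionMapDeriv, reductionMap, reducedField]
  · simp [reductionMapDeriv, reductionMap, reducedField]
    ring
  · simp [reductionMapDeriv, reductionMap, reducedField, lorentz]
    linear_combination 2 * (p.2 0 * p.2 0 + p.2 1 * p.2 1 - p.2 2 * p.2 2 -
      (p.1 1 - p.1 2) * deriv (ratFun U) (p.1 1 - p.1 2)) * h

theorem hasDerivAt_reductionMap {γ : ℝ → (Fin 3 → ℝ) × (Fin 3 → ℝ)}
    {m : (Fin 3 → ℝ) × (Fin 3 → ℝ)} {t : ℝ} (h : HasDerivAt γ m t) :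
    HasDerivAt (fun t => reductionMap (γ t)) (reductionMapDeriv (γ t) m) t := by
  have h1 : ∀ i, HasDerivAt (fun t => (γ t).1 i) (m.1 i) t := hasDerivAt_pi.1 h.fst
  have h2 : ∀ i, HasDerivAt (fun t => (γ t).2 i) (m.2 i) t := hasDerivAt_pi.1 h.snd
  rw [hasDerivAt_pi]
  intro i
  fin_cases i
  · exact (h1 1).sub (h1 2)
  · exact (h2 1).sub (h2 2)
  · refine ((((h2 0).mul (h2 0)).add ((h2 1).mul (h2 1))).sub ((h2 2).mul (h2 2))).congr_deriv ?_
    simp [reductionMapDeriv, lorentz]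
    ring

theorem IsSolution.reductionMap {γ : ℝ → (Fin 3 → ℝ) × (Fin 3 → ℝ)}
    (h : IsSolution (motionField (parabolicPotential U)) (phaseSpace U) I γ) :
    IsSolution (reducedField U) (reducedSpace U) I (fun t => _root_.reductionMap (γ t)) where
  isOpen := h.isOpen
  ordConnected := h.ordConnected
  nonempty := h.nonempty
  mem t ht := ⟨γ t, h.mem t ht, rfl⟩
  hasDerivAt t ht := by
    rw [← reductionMapDeriv_motionField (h.mem t ht)]
    exact hasDerivAt_reductionMap (h.hasDerivAt t ht)

theorem reductionPreimage_singleton {w : Fin 3 → ℝ} (h0 : w 0 < 0) (hr : w 0 ∈ regularArgs U) :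
    reductionPreimage U {w} = ⋃ j ∈ {j : ℝ | j ^ 2 = jSq w}, range (fiberPoint (w 0) (w 1) j) := by
  ext p
  simp only [mem_iUnion, mem_range, exists_prop]
  constructor
  · rintro ⟨hp, hpw⟩
    obtain rfl : reductionMap p = w := hpw
    exact ⟨parabolicMomentum p, (jSq_reductionMap hp.1).symm, p.1 0, (eq_fiberPoint hp.1).symm⟩
  · rintro ⟨j, hj, s, rfl⟩
    refine ⟨fiberPoint_mem_phaseSpace h0 hr _ _ _, ?_⟩
    have h0' := h0.ne
    have hj' : j ^ 2 = jSq w := hj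
    rw [mem_preimage, reductionMap_fiberPoint h0', hj', mem_singleton_iff]
    funext i
    fin_cases i
    · rfl
    · rfl
    · simp [jSq]; field_simp

/-! ### Relative equilibria -/

/-- The linear coefficient of the parabola over a relative equilibrium. -/
noncomputable def fiberVelocity (ρ j : ℝ) : (Fin 3 → ℝ) × (Fin 3 → ℝ) :=
  (![1, 0, 0], ![0, -j / ρ ^ 2, -j / ρ ^ 2])

/-- The quadratic coefficient of the parabola over a relative equilibrium. -/
noncomputable def fiberAcceleration (ρ : ℝ) : (Fin 3 → ℝ) × (Fin 3 → ℝ) :=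
  (![0, -1 / (2 * ρ), -1 / (2 * ρ)], 0)

theorem fiberPoint_eq_parabola {ρ : ℝ} (hρ : ρ ≠ 0) (j s : ℝ) :
    fiberPoint ρ 0 j s =
      fiberPoint ρ 0 j 0 + s • fiberVelocity ρ j + s ^ 2 • fiberAcceleration ρ := by
  refine Prod.ext (funext fun i => ?_) (funext fun i => ?_) <;> fin_cases i <;>
    simp [fiberPoint, fiberVelocity, fiberAcceleration] <;> field_simp <;> ring

theorem isParabola_range_fiberPoint {ρ : ℝ} (hρ : ρ ≠ 0) (j : ℝ) :
    IsParabola (range (fiberPoint ρ 0 j)) := by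
  refine ⟨fiberPoint ρ 0 j 0, fiberVelocity ρ j, fiberAcceleration ρ, ?_, ?_⟩
  · rw [LinearIndependent.pair_iff]
    intro a b hab
    have h0 := congrFun (congrArg Prod.fst hab) 0
    have h1 := congrFun (congrArg Prod.fst hab) 1
    simp [fiberVelocity, fiberAcceleration] at h0 h1
    exact ⟨h0, h1.resolve_right hρ⟩
  · exact congrArg range (funext fun s => fiberPoint_eq_parabola hρ j s)

/-- On this fibre the multiplier ⟨y, y⟩_L - ρ U'(ρ) of x vanishes, so the acceleration is the
constant -∇_L V. The parabola is traversed with x₁ moving at constant speed j / ρ ≠ 0, for all time.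
-/
theorem isTrajectory_range_fiberPoint {ρ j : ℝ} (hr : ρ ∈ regularArgs U) (hρ : ρ < 0)
    (hj : j ≠ 0) (hjρ : j ^ 2 = ρ ^ 3 * deriv (ratFun U) ρ) :
    IsTrajectory (motionField (parabolicPotential U)) (phaseSpace U)
      (range (fiberPoint ρ 0 j)) := by
  have hρ' := hρ.ne
  refine ⟨univ, fun t => fiberPoint ρ 0 j (j / ρ * t),
    ⟨⟨isOpen_univ, ordConnected_univ, univ_nonempty,
      fun t _ => fiberPoint_mem_phaseSpace hρ hr _ _ _, fun t _ => ?_⟩,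
      fun _ _ _ _ _ => subset_univ _⟩, ?_⟩
  · have hs : HasDerivAt (fun t : ℝ => j / ρ * t) (j / ρ) t := by
      simpa using (hasDerivAt_id t).const_mul (j / ρ)
    have hd := ((hs.smul_const (fiberVelocity ρ j)).const_add (fiberPoint ρ 0 j 0)).add
      ((hs.pow 2).smul_const (fiberAcceleration ρ))
    have hfun : (fun t => fiberPoint ρ 0 j (j / ρ * t)) = fun t : ℝ =>
        fiberPoint ρ 0 j 0 + (j / ρ * t) • fiberVelocity ρ j +
          (j / ρ * t) ^ 2 • fiberAcceleration ρ :=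
      funext fun t => fiberPoint_eq_parabola hρ' j _
    rw [hfun]
    refine hd.congr_deriv ?_
    rw [motionField_apply (fiberPoint_mem_phaseSpace hρ hr 0 j (j / ρ * t))]
    have hred := reductionMap_fiberPoint hρ' 0 j (j / ρ * t)
    have h0 : (fiberPoint ρ 0 j (j / ρ * t)).1 1 - (fiberPoint ρ 0 j (j / ρ * t)).1 2 = ρ :=
      congrFun hred 0
    have h2 : lorentz (fiberPoint ρ 0 j (j / ρ * t)).2 (fiberPoint ρ 0 j (j / ρ * t)).2 =
        (j ^ 2 + 0 ^ 2) / ρ ^ 2 := congrFun hred 2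
    have hU : deriv (ratFun U) ρ = j ^ 2 / ρ ^ 3 := by
      rw [hjρ]; field_simp
    have hcoef : (j ^ 2 + 0 ^ 2) / ρ ^ 2 - ρ * (j ^ 2 / ρ ^ 3) = 0 := by
      field_simp
      ring
    rw [h0, h2, hU, hcoef, zero_smul, add_zero]
    refine Prod.ext (funext fun i => ?_) (funext fun i => ?_) <;> fin_cases i <;>
      simp [fiberPoint, fiberVelocity, fiberAcceleration] <;> field_simp
  · rw [image_univ]
    refine Subset.antisymm ?_ ?_
    · rintro _ ⟨s, rfl⟩
      exact ⟨s * (ρ / j), congrArg _ (by field_simp)⟩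
    · rintro _ ⟨t, rfl⟩
      exact ⟨_, rfl⟩

theorem jSq_relEquilibrium (U : RatFunc ℝ) (ρ : ℝ) :
    jSq (relEquilibrium U ρ) = ρ ^ 3 * deriv (ratFun U) ρ := by
  simp [jSq, relEquilibrium]
  ring

theorem reductionPreimage_relEquilibrium {ρ j : ℝ} (hr : ρ ∈ regularArgs U) (hρ : ρ < 0)
    (hjρ : j ^ 2 = ρ ^ 3 * deriv (ratFun U) ρ) :
    reductionPreimage U {relEquilibrium U ρ} =
      range (fiberPoint ρ 0 j) ∪ range (fiberPoint ρ 0 (-j)) := by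
  rw [reductionPreimage_singleton (show relEquilibrium U ρ 0 < 0 from hρ) hr, jSq_relEquilibrium,
    ← hjρ, ← biUnion_pair j (-j) (fun j => range (fiberPoint ρ 0 j))]
  have hset : {i : ℝ | i ^ 2 = j ^ 2} = {j, -j} := by
    ext i
    exact sq_eq_sq_iff_eq_or_eq_neg
  rw [hset]
  rfl

theorem stationaryPoints_reducedField (U : RatFunc ℝ) :
    stationaryPoints (reducedField U) (reducedSpace U) =
      {w | ∃ ρ : ℝ, ρ ∈ regularArgs U ∧ ρ < 0 ∧ 0 ≤ ρ * deriv (ratFun U) ρ ∧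
        w = relEquilibrium U ρ} := by
  ext w
  constructor
  · rintro ⟨hw, hF⟩
    obtain ⟨h0, hr, hj⟩ := mem_reducedSpace_iff.1 hw
    have h1 : w 1 = 0 := congrFun hF 0
    have h2 : w 0 * w 2 - w 0 ^ 2 * deriv (ratFun U) (w 0) = 0 := congrFun hF 1
    have h2' : w 2 = w 0 * deriv (ratFun U) (w 0) := by
      refine mul_left_cancel₀ h0.ne ?_
      linear_combination h2
    refine ⟨w 0, hr, h0, ?_, ?_⟩
    · rw [jSq, h1, h2'] at hj
      have : 0 < w 0 ^ 2 := sq_pos_of_neg h0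
      nlinarith
    · funext i
      fin_cases i
      · rfl
      · exact h1
      · exact h2'
  · rintro ⟨ρ, hr, hρ, hU, rfl⟩
    refine ⟨mem_reducedSpace_iff.2 ⟨hρ, hr, ?_⟩, ?_⟩
    · rw [jSq_relEquilibrium]
      nlinarith [mul_nonneg (sq_nonneg ρ) hU]
    · funext i
      fin_cases i
      · rfl
      · simp [reducedField, relEquilibrium]; ring
      · simp [reducedField, relEquilibrium]

/-! ### Inverse images of trajectories -/

/-- The fibre over a single point is already unbounded, as x₁ takes every real value on it. -/
theorem not_isBounded_reductionPreimage {T : Set (Fin 3 → ℝ)} (hT : T ⊆ reducedSpace U)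
    (hne : T.Nonempty) : ¬ Bornology.IsBounded (reductionPreimage U T) := by
  intro hb
  obtain ⟨C, hC⟩ := hb.exists_norm_le
  obtain ⟨w, hw⟩ := hne
  obtain ⟨h0, hr, hj⟩ := mem_reducedSpace_iff.1 (hT hw)
  have hmem : fiberPoint (w 0) (w 1) (√(jSq w)) (C + 1) ∈ reductionPreimage U {w} := by
    rw [reductionPreimage_singleton h0 hr]
    exact mem_biUnion (Real.sq_sqrt hj) ⟨_, rfl⟩
  have hle := hC _ ⟨hmem.1, singleton_subset_iff.2 hw hmem.2⟩
  have h1 := (norm_le_pi_norm _ 0).trans ((norm_fst_le _).trans hle)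
  have h2 : ‖C + 1‖ ≤ C := h1
  linarith [Real.le_norm_self (C + 1)]

/-- A solution of the motion projects to a reduced solution, which by uniqueness stays on the
maximal one it meets, up to a shift of time. -/
theorem isInvariantSet_reductionPreimage {γ : ℝ → (Fin 3 → ℝ)}
    (hγ : IsMaximalSolution (reducedField U) (reducedSpace U) I γ) :
    IsInvariantSet (motionField (parabolicPotential U)) (phaseSpace U)
      (reductionPreimage U (γ '' I)) := by
  refine ⟨inter_subset_left, ?_⟩
  rintro J δ hδ ⟨t, ht, -, s, hs, hst⟩ u hu
  refine ⟨hδ.mem u hu, ?_⟩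
  have hγ' := hγ.comp_add (s - t)
  have ht' : t ∈ {v | v + (s - t) ∈ I} := by simpa using hs
  have h' : γ (t + (s - t)) = reductionMap (δ t) := by simpa using hst
  exact ⟨_, hγ'.subset_of_eq contDiffAt_reducedField_of_mem hδ.reductionMap ht' ht h' hu,
    hγ'.eqOn_of_eq contDiffAt_reducedField_of_mem hδ.reductionMap ht' ht h' hu⟩

theorem reducedField_eq_zero_of_stationary
    (hp : p ∈ stationaryPoints (motionField (parabolicPotential U)) (phaseSpace U)) :
    reducedField U (reductionMap p) = 0 := by
  rw [← reductionMapDeriv_motionField hp.1, hp.2]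
  funext i
  fin_cases i <;> simp [reductionMapDeriv, lorentz]

end Motion

theorem mainTheorem7 (U : RatFunc ℝ) :
    -- (a) relative equilibria
    (stationaryPoints (reducedField U) (reducedSpace U) =
      {w | ∃ ρ : ℝ, ρ ∈ regularArgs U ∧ ρ < 0 ∧ 0 ≤ ρ * deriv (ratFun U) ρ ∧
        w = relEquilibrium U ρ}) ∧
    (∀ ρ : ℝ, ρ ∈ regularArgs U → ρ < 0 → 0 ≤ ρ * deriv (ratFun U) ρ →
      (deriv (ratFun U) ρ ≠ 0 →
        ∃ A B : Set ((Fin 3 → ℝ) × (Fin 3 → ℝ)), IsParabola A ∧ IsParabola B ∧ Disjoint A B ∧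
          reductionPreimage U {relEquilibrium U ρ} = A ∪ B ∧
          IsTrajectory (motionField (parabolicPotential U)) (phaseSpace U) A ∧
          IsTrajectory (motionField (parabolicPotential U)) (phaseSpace U) B) ∧
      (deriv (ratFun U) ρ = 0 →
        IsParabola (reductionPreimage U {relEquilibrium U ρ}) ∧
        reductionPreimage U {relEquilibrium U ρ} ⊆
          stationaryPoints (motionField (parabolicPotential U)) (phaseSpace U))) ∧
    -- (b) nonstationary solutions lie on level sets
    (∀ (I : Set ℝ) (γ : ℝ → (Fin 3 → ℝ)),
      IsSolution (reducedField U) (reducedSpace U) I γ → IsNonstationary (reducedField U) I γ →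
      ∃ c₁ c₂ : ℝ, 0 ≤ c₁ ∧ γ '' I ⊆ levelSet U c₁ c₂) ∧
    (∀ c₁ c₂ : ℝ, 0 ≤ c₁ →
      -- smoothness at nonstationary points
      (∀ w ∈ levelSet U c₁ c₂, reducedField U w ≠ 0 →
        Function.Surjective (fderiv ℝ (fun z : Fin 3 → ℝ => (jSq z, redHam U z)) w) ∧
        IsSmoothCurveAt (levelSet U c₁ c₂) w) ∧
      -- level sets without stationary points
      ((∀ w ∈ levelSet U c₁ c₂, reducedField U w ≠ 0) →
        IsOneDimSubmanifold (levelSet U c₁ c₂) ∧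
        ∀ w ∈ levelSet U c₁ c₂, IsTrajectory (reducedField U) (reducedSpace U)
          (connectedComponentIn (levelSet U c₁ c₂) w)) ∧
      -- arbitrary level sets, in particular those with stationary points
      (∃ 𝒯 : Set (Set (Fin 3 → ℝ)),
        (∀ T ∈ 𝒯, IsTrajectory (reducedField U) (reducedSpace U) T) ∧
        ⋃₀ 𝒯 = levelSet U c₁ c₂ \ stationaryPoints (reducedField U) (reducedSpace U)) ∧
      (∀ (I : Set ℝ) (γ : ℝ → (Fin 3 → ℝ)),
        IsMaximalSolution (reducedField U) (reducedSpace U) I γ →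
        IsNonstationary (reducedField U) I γ → γ '' I ⊆ levelSet U c₁ c₂ →
        (IsPeriodicSolution I γ ∧
          ∀ t ∈ I, connectedComponentIn (levelSet U c₁ c₂) (γ t) = γ '' I) ∨
        (forwardLimitSet I γ ⊆
            stationaryPoints (reducedField U) {w | w 0 ∈ regularArgs U} ∧
          backwardLimitSet I γ ⊆
            stationaryPoints (reducedField U) {w | w 0 ∈ regularArgs U}))) ∧
    -- (c) inverse images of nonstationary solutions
    (∀ (I : Set ℝ) (γ : ℝ → (Fin 3 → ℝ)),
      IsMaximalSolution (reducedField U) (reducedSpace U) I γ →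
      IsNonstationary (reducedField U) I γ →
      ¬ Bornology.IsBounded (reductionPreimage U (γ '' I)) ∧
      IsInvariantSet (motionField (parabolicPotential U)) (phaseSpace U)
        (reductionPreimage U (γ '' I)) ∧
      Disjoint (reductionPreimage U (γ '' I))
        (stationaryPoints (motionField (parabolicPotential U)) (phaseSpace U))) := by
  have hF := contDiffAt_reducedField_of_mem (U := U)
  refine ⟨stationaryPoints_reducedField U, ?_, ?_, ?_, ?_⟩
  · intro ρ hr hρ hU
    refine ⟨fun hne => ?_, fun h0 => ?_⟩
    · have hpos : 0 < ρ ^ 3 * deriv (ratFun U) ρ := by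
        have : 0 < ρ * deriv (ratFun U) ρ := lt_of_le_of_ne hU (mul_ne_zero hρ.ne hne).symm
        have : 0 < ρ ^ 2 * (ρ * deriv (ratFun U) ρ) := mul_pos (sq_pos_of_neg hρ) this
        linarith
      have hj := Real.sq_sqrt hpos.le
      have hj0 := (Real.sqrt_pos.2 hpos).ne'
      refine ⟨_, _, isParabola_range_fiberPoint hρ.ne _, isParabola_range_fiberPoint hρ.ne _, ?_,
        reductionPreimage_relEquilibrium hr hρ hj, isTrajectory_range_fiberPoint hr hρ hj0 hj,
        isTrajectory_range_fiberPoint hr hρ (neg_ne_zero.2 hj0) (by rw [neg_sq, hj])⟩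
      -- The two parabolas carry the distinct momenta `j` and `-j`.
      rw [Set.disjoint_left]
      rintro _ ⟨s, rfl⟩ ⟨s', hs'⟩
      have := congrArg parabolicMomentum hs'
      rw [parabolicMomentum_fiberPoint hρ.ne, parabolicMomentum_fiberPoint hρ.ne] at this
      exact hj0 (by linarith)
    · have hpre := reductionPreimage_relEquilibrium (j := 0) hr hρ (by rw [h0]; ring)
      rw [neg_zero, union_self] at hpre
      rw [hpre]
      refine ⟨isParabola_range_fiberPoint hρ.ne 0, ?_⟩
      rintro _ ⟨s, rfl⟩
      have hp := fiberPoint_mem_phaseSpace (U := U) hρ hr 0 0 s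
      refine ⟨hp, ?_⟩
      have hred := reductionMap_fiberPoint hρ.ne 0 0 s
      have h1 : (fiberPoint ρ 0 0 s).1 1 - (fiberPoint ρ 0 0 s).1 2 = ρ := congrFun hred 0
      rw [motionField_apply hp, h1, h0]
      refine Prod.ext (funext fun i => ?_) (funext fun i => ?_) <;> fin_cases i <;>
        simp [fiberPoint, lorentz]
  · intro I γ hγ _
    obtain ⟨t, ht⟩ := hγ.nonempty
    refine ⟨jSq (γ t), redHam U (γ t), (mem_reducedSpace_iff.1 (hγ.mem t ht)).2.2, ?_⟩
    rintro _ ⟨s, hs, rfl⟩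
    exact hγ.mem_levelSet ht ⟨hγ.mem t ht, rfl, rfl⟩ hs
  · intro c₁ c₂ hc
    have hex : ∀ w ∈ levelSet U c₁ c₂, ∃ (I : Set ℝ) (γ : ℝ → (Fin 3 → ℝ)),
        IsMaximalSolution (reducedField U) (reducedSpace U) I γ ∧ (0 : ℝ) ∈ I ∧ γ 0 = w ∧
          γ '' I ⊆ levelSet U c₁ c₂ := by
      intro w hw
      obtain ⟨I, γ, hγ, h0, rfl⟩ :=
        (locallySolvable_reducedField U).exists_isMaximalSolution hF hw.1
      refine ⟨I, γ, hγ, h0, rfl, ?_⟩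
      rintro _ ⟨s, hs, rfl⟩
      exact hγ.isSolution.mem_levelSet h0 hw hs
    refine ⟨fun w hw hw0 => ⟨surjective_fderiv_firstIntegrals
      (mem_reducedSpace_iff.1 hw.1).2.1 hw0, isSmoothCurveAt_levelSet hc hw hw0⟩,
      fun hns => ⟨fun w hw => isSmoothCurveAt_levelSet hc hw (hns w hw), fun w hw => ?_⟩, ?_, ?_⟩
    · obtain ⟨I, γ, hγ, h0, rfl, hγL⟩ := hex w hw
      have hcomp := hγ.connectedComponentIn_eq hF hγL
        (fun t ht => isLocalArc_levelSet hc (hγL ⟨t, ht, rfl⟩) (hns _ (hγL ⟨t, ht, rfl⟩)))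
        (fun z hz => hγ.mem_image_of_mem_closure hF hγL
          (isLocalArc_levelSet hc hz.2 (hns z hz.2)) hz.1) h0
      exact ⟨I, γ, hγ, hcomp⟩
    · refine ⟨{T | IsTrajectory (reducedField U) (reducedSpace U) T ∧
        T ⊆ levelSet U c₁ c₂ \ stationaryPoints (reducedField U) (reducedSpace U)},
        fun T hT => hT.1, Subset.antisymm (sUnion_subset fun T hT => hT.2) ?_⟩
      rintro w ⟨hw, hw0⟩
      obtain ⟨I, γ, hγ, h0, rfl, hγL⟩ := hex w hw
      refine ⟨γ '' I, ⟨⟨I, γ, hγ, rfl⟩, ?_⟩, 0, h0, rfl⟩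
      rintro _ ⟨s, hs, rfl⟩
      exact ⟨hγL ⟨s, hs, rfl⟩,
        fun h => hγ.isSolution.ne_zero hF ⟨0, h0, fun h => hw0 ⟨hw.1, h⟩⟩ hs h.2⟩
    · intro I γ hγ hn hγL
      by_cases hp : IsPeriodicSolution I γ
      · refine .inl ⟨hp, fun t ht => hγ.connectedComponentIn_eq hF hγL (fun t ht =>
          isLocalArc_levelSet hc (hγL ⟨t, ht, rfl⟩) (hγ.isSolution.ne_zero hF hn ht)) ?_ ht⟩
        -- A periodic orbit is compact, hence closed, even if the level set has stationary points
        -- elsewhere.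
        rw [(hγ.isCompact_image hp).isClosed.closure_eq]
        exact inter_subset_left
      · obtain ⟨t, ht⟩ := hγ.isSolution.nonempty
        have hcl : ∀ s ⊆ I, closure (γ '' s) ⊆ closure (levelSet U c₁ c₂) :=
          fun s hs => closure_mono ((image_mono hs).trans hγL)
        refine .inr ⟨fun z hz => ?_, fun z hz => ?_⟩
        · obtain ⟨hr, h⟩ := closure_levelSet_subset hc
            (hcl _ inter_subset_left (mem_iInter₂.1 hz t ht))
          -- A nonstationary limit point must lie in the level set itself, hence on a local arc, and
          -- would make the solution periodic.
          refine ⟨hr, by_contra fun hz0 => hp ?_⟩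
          exact hγ.isPeriodicSolution_of_mem_forwardLimitSet hF hγL
            (isLocalArc_levelSet hc (h.resolve_right hz0) hz0) hz
        · obtain ⟨hr, h⟩ := closure_levelSet_subset hc
            (hcl _ inter_subset_left (mem_iInter₂.1 hz t ht))
          refine ⟨hr, by_contra fun hz0 => hp ?_⟩
          exact hγ.isPeriodicSolution_of_mem_backwardLimitSet hF hγL
            (isLocalArc_levelSet hc (h.resolve_right hz0) hz0) hz
  · intro I γ hγ hn
    refine ⟨not_isBounded_reductionPreimage ?_ (hγ.isSolution.nonempty.image γ),
      isInvariantSet_reductionPreimage hγ, ?_⟩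
    · rintro _ ⟨t, ht, rfl⟩
      exact hγ.isSolution.mem t ht
    · rw [Set.disjoint_left]
      rintro p ⟨-, t, ht, htp⟩ hp
      refine hγ.isSolution.ne_zero hF hn ht ?_
      rw [htp]
      exact reducedField_eq_zero_of_stationary hp
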